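/- **Setting.** There are $m\ge 1$ agents, $T\ge 1$ rounds, dimension $d\ge1$ and a finite action set $\mathcal D$. In round $t$ agent $i$ observes context vectors $x_t^i(a)\in\mathbb R^d$, $a\in\mathcal D$, with $\|x_t^i(a)\|_2\le 1$ (they may depend on the past), draws an action $a_t^i$ from a policy $\pi_t^i$ (independently of the other agents given the past), and receives the reward $y_t^i=\theta^*\cdot x_t^i(a_t^i)+\eta_t^i$, with $\theta^*\in\mathbb R^d$ unknown and $\eta_t^i$ i.i.d. centred sub-Gaussian noise, independent of the past and of the actions of round $t$. Agent $i$ has a merit function $f^i:\mathbb R\to\mathbb R$ with $f^i\ge\gamma>0$ and $|f^i(u)-f^i(v)|\le L|u-v|$ for some $L>0$. The optimal fair policy is $\pi_*^i(a)=f^i(\theta^*\cdot x_t^i(a))/\sum_{a'}f^i(\theta^*\cdot x_t^i(a'))$. The fairness regret of agent $i$ is $FR^i=\sum_{t=1}^T\sum_{a\in\mathcal D}|\pi_*^i(a)-\pi_t^i(a)|$, and the (averaged) fairness regret is $FR=\frac1m\sum_{i=1}^m FR^i$. **Algorithm (Fed-FairX-LinUCB).** Let $\lambda>0$, let $g=\lceil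 T/(m d^2\log^2(1+T/d))\rceil$, and let $(\beta_t^i)$ be a given deterministic sequence. The agents communicate at the end of the rounds $\tau_0<\tau_1<\dots$, where $\tau_0=1$, $\tau_{k+1}=2\tau_k$ if $\tau_k<g$ and $\tau_{k+1}=\tau_k+g$ otherwise. Let $t'<t$ be the last communication round before $t$ ($t'=0$ if there is none), and put $z_s^j=x_s^j(a_s^j)$. In round $t$ agent $i$ computes $$V_t^i=\sum_{j=1}^m\Big(\lambda I+\sum_{s\le t'} z_s^j (z_s^j)^{\top}\Big)+\sum_{t'<s<t} z_s^i (z_s^i)^{\top},\qquad b_t^i=\sum_{j=1}^m\sum_{s\le t'}y_s^jz_s^j+\sum_{t'<s<t}y_s^iz_s^i ,$$ $\hat\theta_t^i=(V_t^i)^{-1}b_t^i$ and $CR_t^i=\{\theta:\|\theta-\hat\theta_t^i\|_{V_t^i}\le\sqrt{\beta_t^i}\}$, where $\|v\|_H=\sqrt{v^{\top}Hv}$. It then chooses $\theta_t^i\in CR_t^i$ maximising $\sum_a \frac{f^i(\theta\cdot x_t^i(a))}{\sum_{a'}f^i(\theta\cdot x_t^i(a'))}\,\theta\cdot x_t^i(a)$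 over $\theta\in CR_t^i$, and plays $\pi_t^i(a)=f^i(\theta_t^i\cdot x_t^i(a))/\sum_{a'}f^i(\theta_t^i\cdot x_t^i(a'))$. **Theorem.** For every $\lambda>0$ there is a constant $C>0$ depending only on $\lambda$ such that the following holds for all $m,d,T,\mathcal D,\gamma,L,(f^i),\theta^*,(\beta_t^i)$, all $\nu>1$, $\delta\in(0,1)$ and $\alpha$. If the widths $\beta_t^i$ are such that, with probability at least $1-\alpha$, $\theta^*\in CR_t^i$ for all $i\le m$ and $t\le T$, then with probability at least $1-\alpha-\delta$, $$FR\;\le\;\sum_{i=1}^m FR^i\;\le\; C\sqrt{\log(4/\delta)}\cdot\frac{4\nu L\sqrt{\beta_T}}{\gamma}\sqrt{mTd\log\Big(1+\frac Td\Big)+m^2d^3\log^3\Big(1+\frac Td\Big)},$$ where $\beta_T$ denotes $\max_{t\le T,\,i\le m}\beta_t^i$. -/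

import Mathlib

open MeasureTheory ProbabilityTheory
open scoped Matrix NNReal

namespace FedFairX

noncomputable section

/-! ### Communication schedule (rounds are numbered `1, …, T`) -/

/-- The final gap `⌈T / (m d² log² (1 + T / d))⌉` between two communication rounds. -/
def commGap (m d T : ℕ) : ℕ :=
  ⌈(T : ℝ) / ((m : ℝ) * (d : ℝ) ^ 2 * Real.log (1 + (T : ℝ) / (d : ℝ)) ^ 2)⌉₊

/-- The successive communication rounds: the first one is round `1`; the variable `τ` holding the
next communication round is doubled as long as it is below `commGap`, afterwards it grows by
`commGap` each time. The agents communicate at the end of these rounds. -/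
def commRound (m d T : ℕ) : ℕ → ℕ
  | 0 => 1
  | k + 1 =>
      if commRound m d T k < commGap m d T then 2 * commRound m d T k
      else commRound m d T k + commGap m d T

open Classical in
/-- The last communication round strictly before round `t` (`0` if there is none). -/
def lastComm (m d T t : ℕ) : ℕ :=
  Nat.findGreatest (fun s => ∃ k, commRound m d T k = s) (t - 1)

/-! ### Statistics maintained by the agents

`z s j` is the context vector of the action taken by agent `j` in round `s`, and `y s j` the reward
that agent `j` received in round `s`. At round `t`, agent `i` knows the observations of all the
agents up to the last communication round, and its own later observations before round `t`. -/

/-- Gram matrix `V_t^i`: the shared part `∑_j (lam I + …)` plus the local part. -/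
def gram (m d T : ℕ) (lam : ℝ) (z : ℕ → Fin m → (Fin d → ℝ)) (t : ℕ) (i : Fin m) :
    Matrix (Fin d) (Fin d) ℝ :=
  (∑ j : Fin m, (lam • (1 : Matrix (Fin d) (Fin d) ℝ) +
      ∑ s ∈ Finset.Icc 1 (lastComm m d T t), Matrix.vecMulVec (z s j) (z s j))) +
    ∑ s ∈ Finset.Ico (lastComm m d T t + 1) t, Matrix.vecMulVec (z s i) (z s i)

/-- Reward vector `b_t^i`. -/
def rewardVec (m d T : ℕ) (z : ℕ → Fin m → (Fin d → ℝ)) (y : ℕ → Fin m → ℝ) (t : ℕ) (i : Fin m) :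
    Fin d → ℝ :=
  (∑ j : Fin m, ∑ s ∈ Finset.Icc 1 (lastComm m d T t), y s j • z s j) +
    ∑ s ∈ Finset.Ico (lastComm m d T t + 1) t, y s i • z s i

/-- Ridge regression estimate `(V_t^i)⁻¹ b_t^i`. -/
def thetaHat (m d T : ℕ) (lam : ℝ) (z : ℕ → Fin m → (Fin d → ℝ)) (y : ℕ → Fin m → ℝ)
    (t : ℕ) (i : Fin m) : Fin d → ℝ :=
  (gram m d T lam z t i)⁻¹ *ᵥ rewardVec m d T z y t i

/-- The norm `‖v‖_H = √(vᵀ H v)`. -/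
def matNorm {d : ℕ} (H : Matrix (Fin d) (Fin d) ℝ) (v : Fin d → ℝ) : ℝ :=
  √(v ⬝ᵥ (H *ᵥ v))

/-- Confidence region of agent `i` in round `t`, of radius `√b`. -/
def confSet (m d T : ℕ) (lam b : ℝ) (z : ℕ → Fin m → (Fin d → ℝ)) (y : ℕ → Fin m → ℝ)
    (t : ℕ) (i : Fin m) : Set (Fin d → ℝ) :=
  {θ | matNorm (gram m d T lam z t i) (θ - thetaHat m d T lam z y t i) ≤ √b}

/-! ### Fair policies -/

/-- Policy choosing action `a` with probability proportional to its merit `f (θ · x(a))`. -/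
def fairPolicy {d K : ℕ} (f : ℝ → ℝ) (θ : Fin d → ℝ) (X : Fin K → (Fin d → ℝ)) (a : Fin K) : ℝ :=
  f (θ ⬝ᵥ X a) / ∑ a' : Fin K, f (θ ⬝ᵥ X a')

/-- Expected reward, under parameter `θ`, of the fair policy built from `θ`. -/
def fairValue {d K : ℕ} (f : ℝ → ℝ) (θ : Fin d → ℝ) (X : Fin K → (Fin d → ℝ)) : ℝ :=
  ∑ a : Fin K, fairPolicy f θ X a * (θ ⬝ᵥ X a)

/-! ### Executions of the algorithm -/

/-- A (random) execution of Fed-FairX-LinUCB with `m` agents, dimension `d`, `T` rounds, `K` actions,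
true parameter `θstar`, merit functions `f`, regularisation `lam` and confidence widths `β`.
`hist t` is everything determined before the actions of round `t` are drawn: the observations of
the previous rounds, the contexts of round `t`, and the optimistic parameters of round `t`. -/
structure Run {Ω : Type*} [mΩ : MeasurableSpace Ω] (μ : Measure Ω) (m d T K : ℕ)
    (θstar : Fin d → ℝ) (f : Fin m → ℝ → ℝ) (lam : ℝ) (β : ℕ → Fin m → ℝ) where
  /-- information available before the actions of a round are drawn -/
  hist : Filtration ℕ mΩ
  /-- contexts `x_t^i(a)` -/
  ctx : ℕ → Fin m → Ω → Fin K → (Fin d → ℝ)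
  /-- selected actions -/
  act : ℕ → Fin m → Ω → Fin K
  /-- reward noise -/
  noise : ℕ → Fin m → Ω → ℝ
  /-- optimistic parameters `θ_t^i` -/
  opt : ℕ → Fin m → Ω → (Fin d → ℝ)
  /-- sub-Gaussian variance proxy of the noise -/
  varProxy : ℝ≥0
  ctx_meas : ∀ t ∈ Finset.Icc 1 T, ∀ i a, Measurable[hist t] fun ω => ctx t i ω a
  ctx_norm : ∀ t ∈ Finset.Icc 1 T, ∀ i ω a, ‖WithLp.toLp 2 (ctx t i ω a)‖ ≤ 1
  opt_meas : ∀ t ∈ Finset.Icc 1 T, ∀ i, Measurable[hist t] (opt t i)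
  act_meas : ∀ t ∈ Finset.Icc 1 T, ∀ i, Measurable[hist (t + 1)] (act t i)
  noise_meas : ∀ t ∈ Finset.Icc 1 T, ∀ i, Measurable[hist (t + 1)] (noise t i)
  /-- the noise is i.i.d. over observations, centred and sub-Gaussian, and it is independent of
  the past and of the actions of its round -/
  noise_iIndep :
    iIndepFun (fun p : Finset.Icc 1 T × Fin m => noise (p.1 : ℕ) p.2) μ
  noise_ident : ∀ s ∈ Finset.Icc 1 T, ∀ t ∈ Finset.Icc 1 T, ∀ i j,
    IdentDistrib (noise s i) (noise t j) μ μ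
  noise_mean : ∀ t ∈ Finset.Icc 1 T, ∀ i, ∫ ω, noise t i ω ∂μ = 0
  noise_subG : ∀ t ∈ Finset.Icc 1 T, ∀ i, HasSubgaussianMGF (noise t i) varProxy μ
  noise_indep : ∀ t ∈ Finset.Icc 1 T,
    Indep (⨆ i, MeasurableSpace.comap (noise t i) inferInstance)
      (hist t ⊔ ⨆ i, MeasurableSpace.comap (act t i) ⊤) μ
  /-- `θ_t^i` lies in the confidence region of agent `i` … -/
  opt_mem : ∀ t ∈ Finset.Icc 1 T, ∀ i ω,
    opt t i ω ∈ confSet m d T lam (β t i) (fun s j => ctx s j ω (act s j ω))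
      (fun s j => θstar ⬝ᵥ ctx s j ω (act s j ω) + noise s j ω) t i
  /-- … and maximises the value of the fair policy over that region -/
  opt_max : ∀ t ∈ Finset.Icc 1 T, ∀ i ω,
    ∀ θ ∈ confSet m d T lam (β t i) (fun s j => ctx s j ω (act s j ω))
      (fun s j => θstar ⬝ᵥ ctx s j ω (act s j ω) + noise s j ω) t i,
    fairValue (f i) θ (ctx t i ω) ≤ fairValue (f i) (opt t i ω) (ctx t i ω)
  /-- given the past, the agents draw their actions independently, agent `i` from the fair policy
  built from `θ_t^i` -/
  act_law : ∀ t ∈ Finset.Icc 1 T, ∀ c : Fin m → Fin K,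
    μ[Set.indicator {ω | ∀ i, act t i ω = c i} (fun _ => (1 : ℝ)) | hist t]
      =ᵐ[μ] fun ω => ∏ i : Fin m, fairPolicy (f i) (opt t i ω) (ctx t i ω) (c i)

namespace Run

variable {Ω : Type*} [mΩ : MeasurableSpace Ω] {μ : Measure Ω} {m d T K : ℕ}
  {θstar : Fin d → ℝ} {f : Fin m → ℝ → ℝ} {lam : ℝ} {β : ℕ → Fin m → ℝ}

/-- Context vector of the action taken by agent `i` in round `t`. -/
def chosen (R : Run μ m d T K θstar f lam β) (ω : Ω) (t : ℕ) (i : Fin m) : Fin d → ℝ :=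
  R.ctx t i ω (R.act t i ω)

/-- Reward of agent `i` in round `t`. -/
def reward (R : Run μ m d T K θstar f lam β) (ω : Ω) (t : ℕ) (i : Fin m) : ℝ :=
  θstar ⬝ᵥ R.chosen ω t i + R.noise t i ω

/-- Confidence region of agent `i` in round `t`. -/
def confRegion (R : Run μ m d T K θstar f lam β) (ω : Ω) (t : ℕ) (i : Fin m) :
    Set (Fin d → ℝ) :=
  confSet m d T lam (β t i) (R.chosen ω) (R.reward ω) t i

/-- Policy `π_t^i` played by agent `i` in round `t`. -/
def policy (R : Run μ m d T K θstar f lam β) (ω : Ω) (t : ℕ) (i : Fin m) (a : Fin K) : ℝ :=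
  fairPolicy (f i) (R.opt t i ω) (R.ctx t i ω) a

/-- Optimal fair policy of agent `i` for the contexts of round `t`. -/
def optPolicy (R : Run μ m d T K θstar f lam β) (ω : Ω) (t : ℕ) (i : Fin m) (a : Fin K) : ℝ :=
  fairPolicy (f i) θstar (R.ctx t i ω) a

/-- Instantaneous fairness regret `FR_t^i`. -/
def instRegret (R : Run μ m d T K θstar f lam β) (ω : Ω) (t : ℕ) (i : Fin m) : ℝ :=
  ∑ a : Fin K, |R.optPolicy ω t i a - R.policy ω t i a|

/-- Fairness regret `FR^i` of agent `i` over the `T` rounds. -/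
def agentRegret (R : Run μ m d T K θstar f lam β) (ω : Ω) (i : Fin m) : ℝ :=
  ∑ t ∈ Finset.Icc 1 T, R.instRegret ω t i

/-- Fairness regret, averaged over the agents. -/
def fairnessRegret (R : Run μ m d T K θstar f lam β) (ω : Ω) : ℝ :=
  (1 / (m : ℝ)) * ∑ i : Fin m, R.agentRegret ω i

end Run

/-- The largest confidence width `max_{t ≤ T, i} β_t^i` (this is `β_T = max_i β_T^i` when `β` is
nondecreasing in time). -/
def betaMax (m T : ℕ) (β : ℕ → Fin m → ℝ) : ℝ :=
  ⨆ p : Finset.Icc 1 T × Fin m, β (p.1 : ℕ) p.2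

/-- `(4 ν L √b / γ) · √(m T d log(1 + T/d) + m² d³ log³(1 + T/d))`. -/
def regretRate (m d T : ℕ) (ν L γ b : ℝ) : ℝ :=
  4 * ν * L * √b / γ *
    √((m : ℝ) * T * d * Real.log (1 + (T : ℝ) / d) +
      (m : ℝ) ^ 2 * (d : ℝ) ^ 3 * Real.log (1 + (T : ℝ) / d) ^ 3)

end

end FedFairX

/-! Since merits are Lipschitz and at least γ, the gap between two fair policies is at most 2L/γ
times the mean of |θ*·x - θ_t·x| under the policy actually played (`sum_abs_fairPolicy_sub_le`).
When θ* and θ_t lie in the same confidence ellipsoid, this difference is at most 2√β times the bonus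
of x, its norm for the inverse Gram matrix (`abs_dotProduct_sub_le`). The mean bonuses of a round
exceed those of the drawn actions by a martingale difference of size at most √(m/λ), so `azuma` lets
the drawn bonuses replace the mean ones at a cost of order √(mT log(1/δ)/λ).

What remains is a pathwise bound on the drawn bonuses (`sum_sqrt_invForm_le`). Rounds are cut into
epochs between communications, and Δ denotes the growth of the log-determinant of the pooled Gram
matrix over an epoch of n rounds. If Δ ≤ 1, the pooled matrices at the two ends agree up to a factor
e, so the data of all agents share one elliptical potential and the epoch costs √(e·mnΔ);
Cauchy–Schwarz over the epochs gives √(e·mTR), where R is the total growth. If Δ ≥ 1, each agent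
uses the potential of its own data, at cost of order √(gΔ) ≤ √g·Δ for a gap g; these epochs cost
m√g·R in all. Finally R = O(X) with X = d log(1 + T/d), and g ≤ T/(mX²) + 1 turns the second cost
into order √(mT + m²X²). As X ≥ 1/2, both costs are of order √(mTX + m²X³). -/

namespace FedFairX

/-! ### Quadratic forms of inverse matrices and rank one updates -/

section LinearAlgebra

variable {n ι : Type*} [Fintype n] [DecidableEq n]

/-- The quadratic form `x ↦ xᵀ A⁻¹ x`. -/
noncomputable def invForm (A : Matrix n n ℝ) (x : n → ℝ) : ℝ := x ⬝ᵥ (A⁻¹ *ᵥ x)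

/-- The matrix `A + ∑_{i ∈ s} z_i z_iᵀ`. -/
noncomputable def update (A : Matrix n n ℝ) (s : Finset ι) (z : ι → n → ℝ) : Matrix n n ℝ :=
  A + ∑ i ∈ s, Matrix.vecMulVec (z i) (z i)

omit [DecidableEq n] in
lemma dotProduct_mulVec_comm {A : Matrix n n ℝ} (hA : A.IsHermitian) (x y : n → ℝ) :
    x ⬝ᵥ (A *ᵥ y) = y ⬝ᵥ (A *ᵥ x) := by
  rw [Matrix.dotProduct_mulVec, dotProduct_comm, ← Matrix.mulVec_transpose]
  congr 2

omit [DecidableEq n] in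
lemma quadForm_nonneg {A : Matrix n n ℝ} (hA : A.PosDef) (x : n → ℝ) : 0 ≤ x ⬝ᵥ (A *ᵥ x) := by
  simpa using hA.posSemidef.dotProduct_mulVec_nonneg x

lemma invForm_nonneg {A : Matrix n n ℝ} (hA : A.PosDef) (x : n → ℝ) : 0 ≤ invForm A x :=
  quadForm_nonneg hA.inv x

lemma mulVec_inv_mulVec {A : Matrix n n ℝ} (hA : A.PosDef) (x : n → ℝ) : A *ᵥ (A⁻¹ *ᵥ x) = x := by
  rw [Matrix.mulVec_mulVec, Matrix.mul_nonsing_inv _ ((Matrix.isUnit_iff_isUnit_det A).1 hA.isUnit),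
    Matrix.one_mulVec]

lemma inv_mulVec_mulVec {A : Matrix n n ℝ} (hA : A.PosDef) (x : n → ℝ) : A⁻¹ *ᵥ (A *ᵥ x) = x := by
  rw [Matrix.mulVec_mulVec, Matrix.nonsing_inv_mul _ ((Matrix.isUnit_iff_isUnit_det A).1 hA.isUnit),
    Matrix.one_mulVec]

/-- Cauchy–Schwarz inequality for the dual pair of norms given by `A⁻¹` and `A`. -/
lemma sq_dotProduct_le {A : Matrix n n ℝ} (hA : A.PosDef) (z u : n → ℝ) :
    (z ⬝ᵥ u) ^ 2 ≤ invForm A z * (u ⬝ᵥ (A *ᵥ u)) := by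
  -- The form of `A` at `u - c • A⁻¹ z` is a nonnegative quadratic in `c`, so its discriminant is
  -- nonpositive.
  have key : ∀ c : ℝ, 0 ≤ invForm A z * (c * c) + (-2 * (z ⬝ᵥ u)) * c + u ⬝ᵥ (A *ᵥ u) := by
    intro c
    have h := quadForm_nonneg hA (u - c • (A⁻¹ *ᵥ z))
    have h1 : (A⁻¹ *ᵥ z) ⬝ᵥ (A *ᵥ u) = z ⬝ᵥ u := by
      rw [dotProduct_mulVec_comm hA.isHermitian, mulVec_inv_mulVec hA, dotProduct_comm]
    have h2 : (A⁻¹ *ᵥ z) ⬝ᵥ z = invForm A z := dotProduct_comm _ _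
    rw [Matrix.mulVec_sub, Matrix.mulVec_smul, mulVec_inv_mulVec hA] at h
    simp only [sub_dotProduct, dotProduct_sub, smul_dotProduct, dotProduct_smul, smul_eq_mul, h1,
      h2, dotProduct_comm u z] at h
    linarith
  have := discrim_le_zero key
  rw [discrim] at this
  nlinarith

omit [DecidableEq n] in
lemma posDef_add_vecMulVec {A : Matrix n n ℝ} (hA : A.PosDef) (z : n → ℝ) :
    (A + Matrix.vecMulVec z z).PosDef :=
  hA.add_posSemidef (by simpa using Matrix.posSemidef_vecMulVec_self_star z)

lemma det_add_vecMulVec {A : Matrix n n ℝ} (hA : A.PosDef) (z : n → ℝ) :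
    (A + Matrix.vecMulVec z z).det = A.det * (1 + invForm A z) := by
  have hu := (Matrix.isUnit_iff_isUnit_det A).1 hA.isUnit
  have h : A + Matrix.vecMulVec z z = A * (1 + Matrix.vecMulVec (A⁻¹ *ᵥ z) z) := by
    rw [mul_add, mul_one, Matrix.mul_vecMulVec, mulVec_inv_mulVec hA]
  rw [h, Matrix.det_mul, Matrix.vecMulVec_eq Unit, Matrix.det_one_add_replicateCol_mul_replicateRow,
    invForm]

/-- With B = A + zzᵀ and u = B⁻¹x one has x = Au + (z·u)z, which expresses both the old and the new
form through u. Monotonicity and its quantitative converse both follow. -/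
lemma invForm_add_vecMulVec {A : Matrix n n ℝ} (hA : A.PosDef) (z x : n → ℝ) :
    invForm A x = invForm (A + Matrix.vecMulVec z z) x +
      (z ⬝ᵥ ((A + Matrix.vecMulVec z z)⁻¹ *ᵥ x)) ^ 2 * (1 + invForm A z) ∧
    invForm (A + Matrix.vecMulVec z z) x =
      ((A + Matrix.vecMulVec z z)⁻¹ *ᵥ x) ⬝ᵥ (A *ᵥ ((A + Matrix.vecMulVec z z)⁻¹ *ᵥ x)) +
      (z ⬝ᵥ ((A + Matrix.vecMulVec z z)⁻¹ *ᵥ x)) ^ 2 := by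
  have hB := posDef_add_vecMulVec hA z
  set B := A + Matrix.vecMulVec z z with hBdef
  set u := B⁻¹ *ᵥ x with hu
  have hx : x = A *ᵥ u + (z ⬝ᵥ u) • z := by
    conv_lhs => rw [← mulVec_inv_mulVec hB x]
    rw [← hu, hBdef, Matrix.add_mulVec, Matrix.vecMulVec_mulVec]
    simp
  have hAx : A⁻¹ *ᵥ x = u + (z ⬝ᵥ u) • (A⁻¹ *ᵥ z) := by
    conv_lhs => rw [hx]
    rw [Matrix.mulVec_add, Matrix.mulVec_smul, inv_mulVec_mulVec hA]
  have hq : invForm B x = x ⬝ᵥ u := rfl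
  have h1 : z ⬝ᵥ (A⁻¹ *ᵥ x) = (z ⬝ᵥ u) * (1 + invForm A z) := by
    rw [hAx, dotProduct_add, dotProduct_smul, smul_eq_mul, invForm]; ring
  constructor
  · rw [hq, invForm, hAx, dotProduct_add, dotProduct_smul, smul_eq_mul,
      dotProduct_mulVec_comm hA.inv.isHermitian x z, h1]
    ring
  · rw [hq]
    conv_lhs => rw [hx]
    rw [add_dotProduct, smul_dotProduct, smul_eq_mul, dotProduct_comm]
    ring

lemma invForm_add_vecMulVec_le {A : Matrix n n ℝ} (hA : A.PosDef) (z x : n → ℝ) :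
    invForm (A + Matrix.vecMulVec z z) x ≤ invForm A x := by
  have h := (invForm_add_vecMulVec hA z x).1
  have := invForm_nonneg hA z
  rw [h]
  have : 0 ≤ (z ⬝ᵥ ((A + Matrix.vecMulVec z z)⁻¹ *ᵥ x)) ^ 2 * (1 + invForm A z) := by positivity
  linarith

/-- By the two identities this reduces to (z·u)² ≤ `invForm A z` · uᵀAu, which is Cauchy–Schwarz.
The factor is exactly the growth of the determinant. -/
lemma invForm_le_mul_invForm_add_vecMulVec {A : Matrix n n ℝ} (hA : A.PosDef) (z x : n → ℝ) :
    invForm A x ≤ (1 + invForm A z) * invForm (A + Matrix.vecMulVec z z) x := by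
  obtain ⟨h, h'⟩ := invForm_add_vecMulVec hA z x
  have hcs := sq_dotProduct_le hA z ((A + Matrix.vecMulVec z z)⁻¹ *ᵥ x)
  rw [h]
  conv_rhs => rw [add_mul, one_mul]
  rw [add_le_add_iff_left]
  conv_rhs => rw [h']
  nlinarith

lemma invForm_self_add_vecMulVec_le_log {A : Matrix n n ℝ} (hA : A.PosDef) (z : n → ℝ) :
    invForm (A + Matrix.vecMulVec z z) z ≤ Real.log (1 + invForm A z) := by
  have h := (invForm_add_vecMulVec hA z z).1
  have hr : z ⬝ᵥ ((A + Matrix.vecMulVec z z)⁻¹ *ᵥ z) = invForm (A + Matrix.vecMulVec z z) z := rfl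
  rw [hr] at h
  have hp := invForm_nonneg hA z
  have hq := invForm_nonneg (posDef_add_vecMulVec hA z) z
  set p := invForm A z
  set r := invForm (A + Matrix.vecMulVec z z) z
  -- The identity at x = z reads p = r + r²(1 + p), which factors; r ≥ 0 excludes the second factor.
  have h2 : (r * (1 + p) - p) * (r + 1) = 0 := by linear_combination -h
  have h3 : r * (1 + p) = p := by
    rcases mul_eq_zero.1 h2 with h | h <;> linarith
  have h4 : r = 1 - (1 + p)⁻¹ := by field_simp; linarith
  rw [h4]
  exact Real.one_sub_inv_le_log_of_pos (by linarith)

omit [Fintype n] [DecidableEq n] in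
lemma update_insert [DecidableEq ι] (A : Matrix n n ℝ) {s : Finset ι} {i : ι} (hi : i ∉ s)
    (z : ι → n → ℝ) :
    update A (insert i s) z = update A s z + Matrix.vecMulVec (z i) (z i) := by
  rw [update, update, Finset.sum_insert hi, add_assoc, add_comm (Matrix.vecMulVec _ _)]

omit [Fintype n] [DecidableEq n] in
lemma update_empty (A : Matrix n n ℝ) (z : ι → n → ℝ) : update A ∅ z = A := by simp [update]

omit [DecidableEq n] in
lemma posDef_update {A : Matrix n n ℝ} (hA : A.PosDef) (s : Finset ι) (z : ι → n → ℝ) :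
    (update A s z).PosDef := by
  classical
  induction s using Finset.induction_on with
  | empty => rwa [update_empty]
  | insert i s hi ih => rw [update_insert A hi]; exact posDef_add_vecMulVec ih _

lemma invForm_update_le {A : Matrix n n ℝ} (hA : A.PosDef) (s : Finset ι) (z : ι → n → ℝ)
    (x : n → ℝ) : invForm (update A s z) x ≤ invForm A x := by
  classical
  induction s using Finset.induction_on with
  | empty => rw [update_empty]
  | insert i s hi ih =>
    rw [update_insert A hi]
    exact (invForm_add_vecMulVec_le (posDef_update hA s z) _ _).trans ih

lemma det_le_det_update {A : Matrix n n ℝ} (hA : A.PosDef) (s : Finset ι) (z : ι → n → ℝ) :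
    A.det ≤ (update A s z).det := by
  classical
  induction s using Finset.induction_on with
  | empty => rw [update_empty]
  | insert i s hi ih =>
    have hs := posDef_update hA s z
    rw [update_insert A hi, det_add_vecMulVec hs]
    nlinarith [invForm_nonneg hs (z i), hs.det_pos]

/-- Each rank one update multiplies the determinant by 1 + p and shrinks the inverse form by a
factor of at most 1 + p. Hence a bounded determinant ratio makes the inverse forms comparable. -/
lemma det_mul_invForm_le {A : Matrix n n ℝ} (hA : A.PosDef) (s : Finset ι) (z : ι → n → ℝ)
    (x : n → ℝ) : A.det * invForm A x ≤ (update A s z).det * invForm (update A s z) x := by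
  classical
  induction s using Finset.induction_on with
  | empty => rw [update_empty]
  | insert i s hi ih =>
    have hs := posDef_update hA s z
    rw [update_insert A hi, det_add_vecMulVec hs, mul_assoc]
    exact ih.trans (mul_le_mul_of_nonneg_left (invForm_le_mul_invForm_add_vecMulVec hs _ _)
      hs.det_pos.le)

/-- Elliptical potential lemma with all the vectors measured by the final matrix. -/
lemma sum_invForm_update_le {A : Matrix n n ℝ} (hA : A.PosDef) (s : Finset ι) (z : ι → n → ℝ) :
    ∑ i ∈ s, invForm (update A s z) (z i) ≤ Real.log (update A s z).det - Real.log A.det := by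
  classical
  induction s using Finset.induction_on with
  | empty => simp [update_empty]
  | insert i s hi ih =>
    have hs := posDef_update hA s z
    have hp := invForm_nonneg hs (z i)
    rw [update_insert A hi, Finset.sum_insert hi, det_add_vecMulVec hs,
      Real.log_mul hs.det_pos.ne' (by linarith)]
    -- A new vector only decreases the terms already present, and its own term is paid for by the
    -- growth of the log-determinant.
    have h1 : ∑ j ∈ s, invForm (update A s z + Matrix.vecMulVec (z i) (z i)) (z j) ≤
        ∑ j ∈ s, invForm (update A s z) (z j) :=
      Finset.sum_le_sum fun j _ => invForm_add_vecMulVec_le hs _ _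
    have h2 := invForm_self_add_vecMulVec_le_log hs (z i)
    linarith

/-- Elliptical potential lemma for consecutive rank one updates. -/
lemma sum_log_one_add_invForm {A : Matrix n n ℝ} (hA : A.PosDef) (z : ℕ → n → ℝ) {a b : ℕ}
    (hab : a ≤ b) :
    ∑ t ∈ Finset.Ico a b, Real.log (1 + invForm (update A (Finset.Ico a t) z) (z t)) =
      Real.log (update A (Finset.Ico a b) z).det - Real.log A.det := by
  induction b, hab using Nat.le_induction with
  | base => simp [update_empty]
  | succ b hab ih =>
    have hs := posDef_update hA (Finset.Ico a b) z
    have hp := invForm_nonneg hs (z b)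
    rw [Finset.sum_Ico_succ_top hab, ih, ← Finset.insert_Ico_right_eq_Ico_add_one hab,
      update_insert A (by simp), det_add_vecMulVec hs, Real.log_mul hs.det_pos.ne' (by linarith)]
    ring

/-- AM–GM for the eigenvalues. -/
lemma log_det_le {A : Matrix n n ℝ} (hA : A.PosDef) [Nonempty n] :
    Real.log A.det ≤ Fintype.card n * Real.log (A.trace / Fintype.card n) := by
  have hcard : (0 : ℝ) < Fintype.card n := by exact_mod_cast Fintype.card_pos
  have hpos := hA.eigenvalues_pos
  have hdet : A.det = ∏ i, hA.isHermitian.eigenvalues i := by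
    simpa using hA.isHermitian.det_eq_prod_eigenvalues
  have htr : A.trace = ∑ i, hA.isHermitian.eigenvalues i := by
    simpa using hA.isHermitian.trace_eq_sum_eigenvalues
  have h := Real.geom_mean_le_arith_mean Finset.univ (fun _ => (1 : ℝ)) hA.isHermitian.eigenvalues
    (by simp) (by simpa using hcard) (fun i _ => (hpos i).le)
  simp only [Real.rpow_one, one_mul, Finset.sum_const, Finset.card_univ, nsmul_eq_mul, mul_one,
    ← hdet, ← htr] at h
  have h2 := Real.log_le_log (Real.rpow_pos_of_pos hA.det_pos _) h
  rw [Real.log_rpow hA.det_pos] at h2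
  rwa [inv_mul_le_iff₀ hcard] at h2

omit [DecidableEq n] in
lemma trace_update_le (A : Matrix n n ℝ) (s : Finset ι) (z : ι → n → ℝ)
    (hz : ∀ i ∈ s, z i ⬝ᵥ z i ≤ 1) : (update A s z).trace ≤ A.trace + s.card := by
  rw [update, Matrix.trace_add, Matrix.trace_sum]
  simp only [Matrix.trace_vecMulVec]
  have := Finset.sum_le_card_nsmul s _ 1 hz
  simpa using this

end LinearAlgebra

/-! ### Communication schedule -/

section Schedule

lemma log_pos_of_rounds {d T : ℕ} (hd : 1 ≤ d) (hT : 1 ≤ T) :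
    0 < Real.log (1 + (T : ℝ) / d) := by
  have : (0 : ℝ) < T := by exact_mod_cast hT
  have : (0 : ℝ) < d := by exact_mod_cast hd
  apply Real.log_pos
  have : (0 : ℝ) < T / d := by positivity
  linarith

lemma commGap_pos {m d T : ℕ} (hm : 1 ≤ m) (hd : 1 ≤ d) (hT : 1 ≤ T) : 0 < commGap m d T := by
  have h := log_pos_of_rounds hd hT
  have : (0 : ℝ) < T := by exact_mod_cast hT
  have : (0 : ℝ) < d := by exact_mod_cast hd
  have : (0 : ℝ) < m := by exact_mod_cast hm
  exact Nat.ceil_pos.2 (by positivity)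

/-- Endpoints of the epochs between communications, starting at `0`. -/
noncomputable def epochEnd (m d T : ℕ) : ℕ → ℕ
  | 0 => 0
  | k + 1 => commRound m d T k

lemma commRound_pos (m d T k : ℕ) : 0 < commRound m d T k := by
  induction k with
  | zero => simp [commRound]
  | succ k ih => rw [commRound]; split_ifs <;> omega

lemma epochEnd_lt_succ {m d T : ℕ} (hg : 0 < commGap m d T) (k : ℕ) :
    epochEnd m d T k < epochEnd m d T (k + 1) := by
  cases k with
  | zero => exact commRound_pos m d T 0
  | succ k =>
    have := commRound_pos m d T k
    simp only [epochEnd]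
    rw [commRound.eq_def m d T (k + 1)]
    simp only
    split_ifs <;> omega

/-- Doubling happens only below the gap, so it also adds less than the gap; the initial epoch is a
single round. -/
lemma epochEnd_succ_le {m d T : ℕ} (hg : 0 < commGap m d T) (k : ℕ) :
    epochEnd m d T (k + 1) ≤ epochEnd m d T k + commGap m d T := by
  cases k with
  | zero => simp only [epochEnd, commRound]; omega
  | succ k =>
    simp only [epochEnd]
    rw [commRound.eq_def m d T (k + 1)]
    simp only
    split_ifs <;> omega

lemma strictMono_epochEnd {m d T : ℕ} (hg : 0 < commGap m d T) : StrictMono (epochEnd m d T) :=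
  strictMono_nat_of_lt_succ (epochEnd_lt_succ hg)

/-- The right endpoint belongs to the epoch because communication takes place at the end of a round.
For `k = 0` the value 0 is the default of `Nat.findGreatest`. -/
lemma lastComm_eq {m d T : ℕ} (hg : 0 < commGap m d T) {k t : ℕ}
    (h1 : epochEnd m d T k < t) (h2 : t ≤ epochEnd m d T (k + 1)) :
    lastComm m d T t = epochEnd m d T k := by
  classical
  rw [lastComm, Nat.findGreatest_eq_iff]
  refine ⟨by omega, fun h0 => ?_, ?_⟩
  · cases k with
    | zero => exact absurd rfl h0
    | succ k => exact ⟨k, rfl⟩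
  · rintro s hs hs' ⟨j, hj⟩
    have hj' : epochEnd m d T (j + 1) = s := hj
    have h3 : k < j + 1 := (strictMono_epochEnd hg).lt_iff_lt.1 (by omega)
    have h4 : j + 1 < k + 1 := (strictMono_epochEnd hg).lt_iff_lt.1 (by omega)
    omega

lemma lastComm_lt {m d T t : ℕ} (ht : 1 ≤ t) : lastComm m d T t < t := by
  have : lastComm m d T t ≤ t - 1 := @Nat.findGreatest_le _ (Classical.decPred _) _
  omega

end Schedule

/-! ### Elliptical potential over the epochs -/

section Potential

lemma update_update {n ι : Type*} [DecidableEq ι] (A : Matrix n n ℝ) {s s' : Finset ι}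
    (h : Disjoint s s') (z : ι → n → ℝ) : update (update A s z) s' z = update A (s ∪ s') z := by
  rw [update, update, update, Finset.sum_union h, add_assoc]

lemma det_update_mono {n ι : Type*} [Fintype n] [DecidableEq n] {A : Matrix n n ℝ} (hA : A.PosDef)
    {s s' : Finset ι} (h : s ⊆ s') (z : ι → n → ℝ) : (update A s z).det ≤ (update A s' z).det := by
  classical
  rw [← Finset.union_sdiff_of_subset h, ← update_update A Finset.disjoint_sdiff]
  exact det_le_det_update (posDef_update hA s z) _ _

/-- Gram matrix of the observations of all the agents up to round `k`. -/
noncomputable def pooled (m d : ℕ) (lam : ℝ) (z : ℕ → Fin m → (Fin d → ℝ)) (k : ℕ) :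
    Matrix (Fin d) (Fin d) ℝ :=
  update (((m : ℝ) * lam) • (1 : Matrix (Fin d) (Fin d) ℝ)) (Finset.Ioc 0 k ×ˢ Finset.univ)
    (fun p : ℕ × Fin m => z p.1 p.2)

variable {m d T : ℕ} {lam : ℝ} {z : ℕ → Fin m → (Fin d → ℝ)}

lemma posDef_smul_one (hm : 1 ≤ m) (hlam : 0 < lam) :
    (((m : ℝ) * lam) • (1 : Matrix (Fin d) (Fin d) ℝ)).PosDef :=
  Matrix.PosDef.one.smul (mul_pos (by exact_mod_cast hm) hlam)

lemma posDef_pooled (hm : 1 ≤ m) (hlam : 0 < lam) (k : ℕ) : (pooled m d lam z k).PosDef :=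
  posDef_update (posDef_smul_one hm hlam) _ _

lemma pooled_eq_update {a b : ℕ} (hab : a ≤ b) :
    pooled m d lam z b = update (pooled m d lam z a) (Finset.Ioc a b ×ˢ Finset.univ)
      (fun p : ℕ × Fin m => z p.1 p.2) := by
  rw [pooled, pooled, update_update, ← Finset.union_product,
    Finset.Ioc_union_Ioc_eq_Ioc (by simp) hab]
  rw [Finset.disjoint_product]
  left
  rw [Finset.disjoint_left]
  intro x hx hx'
  simp at hx hx'
  omega

lemma gram_eq_update (t : ℕ) (i : Fin m) :
    gram m d T lam z t i = update (pooled m d lam z (lastComm m d T t))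
      (Finset.Ico (lastComm m d T t + 1) t) (fun s => z s i) := by
  rw [gram, update, pooled, update, Finset.sum_add_distrib, Finset.sum_product_right]
  congr 2
  simp [← smul_assoc]

lemma posDef_gram (hm : 1 ≤ m) (hlam : 0 < lam) (t : ℕ) (i : Fin m) :
    (gram m d T lam z t i).PosDef := by
  rw [gram_eq_update]
  exact posDef_update (posDef_pooled hm hlam _) _ _

lemma invForm_smul_one (c : ℝ) (x : Fin d → ℝ) :
    invForm (c • (1 : Matrix (Fin d) (Fin d) ℝ)) x = c⁻¹ * (x ⬝ᵥ x) := by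
  have h : (c • (1 : Matrix (Fin d) (Fin d) ℝ))⁻¹ = c⁻¹ • 1 := by
    rcases eq_or_ne c 0 with rfl | hc
    · simp
    · exact Matrix.inv_eq_right_inv (by simp [smul_smul, hc])
  rw [invForm, h, Matrix.smul_mulVec, Matrix.one_mulVec, dotProduct_smul, smul_eq_mul]

lemma invForm_gram_le (hm : 1 ≤ m) (hlam : 0 < lam) (t : ℕ) (i : Fin m) {x : Fin d → ℝ}
    (hx : x ⬝ᵥ x ≤ 1) : invForm (gram m d T lam z t i) x ≤ ((m : ℝ) * lam)⁻¹ := by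
  have hm' : (0 : ℝ) < m := by exact_mod_cast hm
  rw [gram_eq_update]
  refine (invForm_update_le (posDef_pooled hm hlam _) _ _ _).trans ?_
  refine (invForm_update_le (posDef_smul_one hm hlam) _ _ _).trans ?_
  rw [invForm_smul_one]
  exact mul_le_of_le_one_right (by positivity) hx

/-- Log-determinant of the pooled Gram matrix. -/
noncomputable def potential (m d : ℕ) (lam : ℝ) (z : ℕ → Fin m → (Fin d → ℝ)) (k : ℕ) : ℝ :=
  Real.log (pooled m d lam z k).det

lemma potential_mono (hm : 1 ≤ m) (hlam : 0 < lam) : Monotone (potential m d lam z) := by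
  intro a b hab
  refine Real.log_le_log (posDef_pooled hm hlam a).det_pos ?_
  rw [pooled_eq_update hab]
  exact det_le_det_update (posDef_pooled hm hlam a) _ _

/-- Trace bound and AM–GM. The regulariser mλ grows with the number of agents just as the amount of
data does, so m cancels. -/
lemma potential_sub_le (hm : 1 ≤ m) (hd : 1 ≤ d) (hlam : 0 < lam)
    (hz : ∀ t ∈ Finset.Icc 1 T, ∀ i, z t i ⬝ᵥ z t i ≤ 1) :
    potential m d lam z T - potential m d lam z 0 ≤ d * Real.log (1 + T / (d * lam)) := by
  have hm' : (0 : ℝ) < m := by exact_mod_cast hm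
  have hd' : (0 : ℝ) < d := by exact_mod_cast hd
  have : Nonempty (Fin d) := ⟨⟨0, hd⟩⟩
  have hP := posDef_pooled (z := z) hm hlam T
  have h0 : potential m d lam z 0 = d * Real.log (m * lam) := by
    simp [potential, pooled, update_empty, ← Real.log_pow]
  have hpos : 0 < (pooled m d lam z T).trace := by
    have := hP.trace_pos
    exact this
  have htr : (pooled m d lam z T).trace ≤ d * (m * lam) + T * m := by
    refine (trace_update_le _ _ _ ?_).trans ?_
    · rintro ⟨t, i⟩ h
      simp at h
      exact hz t (by simp; omega) i
    · simp [mul_comm]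
  have h1 := log_det_le hP
  rw [Fintype.card_fin] at h1
  have h2 : Real.log ((pooled m d lam z T).trace / d) ≤
      Real.log ((m * lam) * (1 + T / (d * lam))) := by
    refine Real.log_le_log (by positivity) ?_
    rw [div_le_iff₀ hd']
    refine htr.trans (le_of_eq ?_)
    field_simp
  rw [Real.log_mul (by positivity) (by positivity)] at h2
  rw [h0, potential]
  have := mul_le_mul_of_nonneg_left h2 hd'.le
  linarith

lemma sum_sqrt_le {ι : Type*} (s : Finset ι) {q : ι → ℝ} (hq : ∀ i, 0 ≤ q i) :
    ∑ i ∈ s, √(q i) ≤ √(s.card * ∑ i ∈ s, q i) := by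
  have := Real.sum_sqrt_mul_sqrt_le s (f := fun _ => (1 : ℝ)) (g := q) (by simp) hq
  simpa [Real.sqrt_mul] using this

lemma le_mul_log_one_add {c x : ℝ} (hx : 0 ≤ x) (hxc : x ≤ c) :
    x ≤ (1 + c) * Real.log (1 + x) := by
  have h := Real.one_sub_inv_le_log_of_pos (show 0 < 1 + x by linarith)
  have h1 : x = (1 + x) * (1 - (1 + x)⁻¹) := by field_simp; ring
  have h0 : 0 ≤ Real.log (1 + x) := Real.log_nonneg (by linarith)
  calc x = (1 + x) * (1 - (1 + x)⁻¹) := h1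
    _ ≤ (1 + x) * Real.log (1 + x) := by gcongr
    _ ≤ _ := by gcongr

/-- An epoch along which the pooled determinant grows by a bounded factor. -/
lemma epoch_sum_le_of_le_one (hm : 1 ≤ m) (hlam : 0 < lam) {a b : ℕ} (hab : a ≤ b)
    (hlast : ∀ t ∈ Finset.Ioc a b, lastComm m d T t = a)
    (hΔ : potential m d lam z b - potential m d lam z a ≤ 1) :
    ∑ t ∈ Finset.Ioc a b, ∑ i, √(invForm (gram m d T lam z t i) (z t i)) ≤
      √(((b - a : ℕ) * m) *
        (Real.exp 1 * (potential m d lam z b - potential m d lam z a))) := by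
  have hA := posDef_pooled (z := z) hm hlam a
  have hB := posDef_pooled (z := z) hm hlam b
  -- Log-determinant growth of at most 1 means a determinant ratio of at most e.
  have hcmp : ∀ x, invForm (pooled m d lam z a) x ≤ Real.exp 1 * invForm (pooled m d lam z b) x := by
    intro x
    have h := det_mul_invForm_le hA (Finset.Ioc a b ×ˢ Finset.univ)
      (fun p : ℕ × Fin m => z p.1 p.2) x
    rw [← pooled_eq_update hab] at h
    have hdet : (pooled m d lam z b).det ≤ Real.exp 1 * (pooled m d lam z a).det := by
      rw [← Real.log_le_log_iff hB.det_pos (mul_pos (Real.exp_pos _) hA.det_pos),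
        Real.log_mul (Real.exp_pos _).ne' hA.det_pos.ne', Real.log_exp]
      simp only [potential] at hΔ
      linarith
    have h2 := h.trans (mul_le_mul_of_nonneg_right hdet (invForm_nonneg hB x))
    refine le_of_mul_le_mul_left (h2.trans (le_of_eq ?_)) hA.det_pos
    ring
  rw [← Finset.sum_product' (Finset.Ioc a b) Finset.univ
    (fun t i => √(invForm (gram m d T lam z t i) (z t i)))]
  have hsqrt := sum_sqrt_le (Finset.Ioc a b ×ˢ (Finset.univ : Finset (Fin m)))
    (q := fun p => invForm (gram m d T lam z p.1 p.2) (z p.1 p.2))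
    (fun p => invForm_nonneg (posDef_gram hm hlam p.1 p.2) _)
  refine hsqrt.trans ?_
  refine Real.sqrt_le_sqrt ?_
  rw [Finset.card_product, Nat.card_Ioc, Finset.card_univ, Fintype.card_fin, Nat.cast_mul]
  refine mul_le_mul_of_nonneg_left ?_ (by positivity)
  have hsum := sum_invForm_update_le hA (Finset.Ioc a b ×ˢ Finset.univ)
      (fun p : ℕ × Fin m => z p.1 p.2)
  rw [← pooled_eq_update hab] at hsum
  refine le_trans ?_ (mul_le_mul_of_nonneg_left hsum (Real.exp_pos 1).le)
  rw [Finset.mul_sum]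
  refine Finset.sum_le_sum fun p hp => ?_
  rw [gram_eq_update, hlast p.1 (Finset.mem_product.1 hp).1]
  -- Local data only lower the form of the stale pooled matrix, which is then compared with the
  -- pooled matrix at the end of the epoch.
  exact (invForm_update_le hA _ _ _).trans (hcmp _)

/-- An epoch along which the pooled determinant grows by a large factor. -/
lemma epoch_sum_le_of_one_le (hm : 1 ≤ m) (hlam : 0 < lam) {a b g : ℕ} (hab : a ≤ b)
    (hg : b ≤ a + g) (hlast : ∀ t ∈ Finset.Ioc a b, lastComm m d T t = a)
    (hz : ∀ t ∈ Finset.Ioc a b, ∀ i, z t i ⬝ᵥ z t i ≤ 1)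
    (hΔ : 1 ≤ potential m d lam z b - potential m d lam z a) :
    ∑ t ∈ Finset.Ioc a b, ∑ i, √(invForm (gram m d T lam z t i) (z t i)) ≤
      m * √(g * (1 + lam⁻¹)) * (potential m d lam z b - potential m d lam z a) := by
  have hm' : (1 : ℝ) ≤ m := by exact_mod_cast hm
  have hA := posDef_pooled (z := z) hm hlam a
  set Δ := potential m d lam z b - potential m d lam z a with hΔdef
  have hIoc : Finset.Ioc a b = Finset.Ico (a + 1) (b + 1) := by ext; simp
  have hagent : ∀ i, ∑ t ∈ Finset.Ioc a b, √(invForm (gram m d T lam z t i) (z t i)) ≤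
      √(g * (1 + lam⁻¹)) * Δ := by
    intro i
    have hq := fun t => invForm_nonneg (posDef_gram (T := T) (z := z) hm hlam t i) (z t i)
    have h1 : ∑ t ∈ Finset.Ioc a b, invForm (gram m d T lam z t i) (z t i) ≤
        (1 + lam⁻¹) * Δ := by
      calc ∑ t ∈ Finset.Ioc a b, invForm (gram m d T lam z t i) (z t i)
          ≤ ∑ t ∈ Finset.Ioc a b,
              (1 + lam⁻¹) * Real.log (1 + invForm (gram m d T lam z t i) (z t i)) := by
            -- Squared bonuses are at most 1/(mλ) ≤ 1/λ, which makes them comparable with their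
            -- logarithms.
            refine Finset.sum_le_sum fun t ht => le_mul_log_one_add (hq t) ?_
            refine (invForm_gram_le hm hlam t i (hz t ht i)).trans ?_
            refine inv_anti₀ hlam ?_
            nlinarith
        _ = (1 + lam⁻¹) * (Real.log (update (pooled m d lam z a) (Finset.Ico (a + 1) (b + 1))
              (fun s => z s i)).det - Real.log (pooled m d lam z a).det) := by
            rw [← Finset.mul_sum, ← sum_log_one_add_invForm hA _ (by omega), ← hIoc]
            congr 1
            refine Finset.sum_congr rfl fun t ht => ?_
            rw [gram_eq_update, hlast t ht]
        _ ≤ (1 + lam⁻¹) * Δ := by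
            refine mul_le_mul_of_nonneg_left ?_ (by positivity)
            refine sub_le_sub_right (Real.log_le_log (posDef_update hA _ _).det_pos ?_) _
            -- The agent's own data form a subset of the data of the epoch, so its log-determinant
            -- growth is at most Δ.
            have h2 : update (pooled m d lam z a) (Finset.Ico (a + 1) (b + 1)) (fun s => z s i) =
                update (pooled m d lam z a) (Finset.Ioc a b ×ˢ {i})
                  (fun p : ℕ × Fin m => z p.1 p.2) := by
              rw [update, update, Finset.sum_product, hIoc]
              simp
            rw [h2, pooled_eq_update hab]
            exact det_update_mono hA (Finset.product_subset_product_right (by simp)) _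
    have hcard : ((Finset.Ioc a b).card : ℝ) ≤ g := by
      rw [Nat.card_Ioc]; exact_mod_cast (by omega)
    calc _ ≤ √((Finset.Ioc a b).card * ∑ t ∈ Finset.Ioc a b,
              invForm (gram m d T lam z t i) (z t i)) := sum_sqrt_le _ hq
      _ ≤ √(g * ((1 + lam⁻¹) * Δ)) := by
          refine Real.sqrt_le_sqrt (mul_le_mul hcard h1 (Finset.sum_nonneg fun t _ => hq t) ?_)
          positivity
      _ = √(g * (1 + lam⁻¹)) * √Δ := by
          rw [← mul_assoc, Real.sqrt_mul (by positivity)]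
      _ ≤ √(g * (1 + lam⁻¹)) * Δ := by
          refine mul_le_mul_of_nonneg_left ?_ (Real.sqrt_nonneg _)
          -- √Δ ≤ Δ because Δ ≥ 1; this makes the bound additive over epochs.
          rw [Real.sqrt_le_left (by linarith)]
          nlinarith
  rw [Finset.sum_comm]
  calc _ ≤ ∑ i : Fin m, √(g * (1 + lam⁻¹)) * Δ := Finset.sum_le_sum fun i _ => hagent i
    _ = _ := by simp; ring

/-- Adding the bounds of the two cases gives one estimate that can be summed without sorting the
epochs. -/
lemma epoch_sum_le (hm : 1 ≤ m) (hlam : 0 < lam) {a b g : ℕ} (hab : a ≤ b)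
    (hg : b ≤ a + g) (hlast : ∀ t ∈ Finset.Ioc a b, lastComm m d T t = a)
    (hz : ∀ t ∈ Finset.Ioc a b, ∀ i, z t i ⬝ᵥ z t i ≤ 1) :
    ∑ t ∈ Finset.Ioc a b, ∑ i, √(invForm (gram m d T lam z t i) (z t i)) ≤
      √(b - a : ℕ) * √(m * Real.exp 1 * (potential m d lam z b - potential m d lam z a)) +
      m * √(g * (1 + lam⁻¹)) * (potential m d lam z b - potential m d lam z a) := by
  have hΔ := sub_nonneg.2 (potential_mono (z := z) (d := d) hm hlam hab)
  rcases le_total (potential m d lam z b - potential m d lam z a) 1 with h | h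
  · refine (epoch_sum_le_of_le_one hm hlam hab hlast h).trans ?_
    rw [← Real.sqrt_mul (by positivity), ← mul_assoc, ← mul_assoc, ← mul_assoc]
    exact le_add_of_nonneg_right (by positivity)
  · refine (epoch_sum_le_of_one_le hm hlam hab hg hlast hz h).trans ?_
    exact le_add_of_nonneg_left (by positivity)

lemma sum_Ioc_eq_sum_range {M : Type*} [AddCommMonoid M] (F : ℕ → M) {G : ℕ → ℕ} (hG : Monotone G)
    (N : ℕ) :
    ∑ t ∈ Finset.Ioc (G 0) (G N), F t =
      ∑ k ∈ Finset.range N, ∑ t ∈ Finset.Ioc (G k) (G (k + 1)), F t := by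
  induction N with
  | zero => simp
  | succ N ih =>
    rw [Finset.sum_range_succ, ← ih, Finset.sum_Ioc_consecutive _ (hG (by omega)) (hG (by omega))]

/-- Sum of the exploration bonuses of all the agents, in terms of the potential. -/
lemma sum_sqrt_invForm_le_potential (hm : 1 ≤ m) (hd : 1 ≤ d) (hT : 1 ≤ T) (hlam : 0 < lam)
    (hz : ∀ t ∈ Finset.Icc 1 T, ∀ i, z t i ⬝ᵥ z t i ≤ 1) :
    ∑ t ∈ Finset.Icc 1 T, ∑ i, √(invForm (gram m d T lam z t i) (z t i)) ≤
      √T * √(m * Real.exp 1 * (potential m d lam z T - potential m d lam z 0)) +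
      m * √(commGap m d T * (1 + lam⁻¹)) * (potential m d lam z T - potential m d lam z 0) := by
  have hg := commGap_pos hm hd hT
  set G : ℕ → ℕ := fun k => min T (epochEnd m d T k) with hGdef
  have hG : Monotone G := fun a b h => min_le_min_left _ ((strictMono_epochEnd hg).monotone h)
  have hG0 : G 0 = 0 := by simp [hGdef, epochEnd]
  -- A strictly increasing sequence of naturals dominates its index, so `T` truncated epochs cover
  -- all rounds.
  have hGT : G T = T := min_eq_left (strictMono_epochEnd hg).le_apply
  have hIcc : Finset.Icc 1 T = Finset.Ioc (G 0) (G T) := by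
    rw [hG0, hGT]; ext; simp; omega
  have hpot := potential_mono (z := z) (d := d) hm hlam
  have hS := sum_Ioc_eq_sum_range
    (fun t => ∑ i, √(invForm (gram m d T lam z t i) (z t i))) hG T
  rw [hIcc, hS]
  have hΔsum : ∑ k ∈ Finset.range T, (potential m d lam z (G (k + 1)) - potential m d lam z (G k)) =
      potential m d lam z T - potential m d lam z 0 := by
    rw [Finset.sum_range_sub (fun k => potential m d lam z (G k)), hG0, hGT]
  have hnsum : ∑ k ∈ Finset.range T, ((G (k + 1) - G k : ℕ) : ℝ) = T := by
    have : ∀ k, ((G (k + 1) - G k : ℕ) : ℝ) = (G (k + 1) : ℝ) - G k := fun k =>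
      Nat.cast_sub (hG (by omega))
    simp only [this]
    rw [Finset.sum_range_sub (fun k => (G k : ℝ)), hG0, hGT]
    simp
  calc _ ≤ ∑ k ∈ Finset.range T, (√(G (k + 1) - G k : ℕ) * √(m * Real.exp 1 *
        (potential m d lam z (G (k + 1)) - potential m d lam z (G k))) +
      m * √(commGap m d T * (1 + lam⁻¹)) *
        (potential m d lam z (G (k + 1)) - potential m d lam z (G k))) := by
        refine Finset.sum_le_sum fun k _ => epoch_sum_le hm hlam (hG (by omega)) ?_ ?_ ?_
        · have := epochEnd_succ_le hg k
          simp only [hGdef]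
          omega
        · intro t ht
          simp only [hGdef, Finset.mem_Ioc] at ht
          rw [lastComm_eq hg (k := k) (by omega) (by omega)]
          simp only [hGdef]
          omega
        · intro t ht
          simp only [hGdef, Finset.mem_Ioc] at ht
          exact hz t (by simp; omega)
    _ ≤ _ := by
        rw [Finset.sum_add_distrib, ← Finset.mul_sum, hΔsum]
        gcongr
        -- Cauchy–Schwarz over the epochs: lengths sum to T and growths telescope.
        refine (Real.sum_sqrt_mul_sqrt_le _ (fun k => by positivity) fun k => ?_).trans ?_
        · exact mul_nonneg (by positivity) (sub_nonneg.2 (hpot (hG (by omega))))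
        · rw [hnsum, ← Finset.mul_sum, hΔsum]

end Potential

/-! ### Reduction of the potential bound to the stated rate -/

section Numeric

/-- Bernoulli: (1 + x)^(1 + 1/λ) ≥ 1 + (1 + 1/λ)x ≥ 1 + x/λ. This moves λ into the constant. -/
lemma log_one_add_div_le {lam x : ℝ} (hlam : 0 < lam) (hx : 0 ≤ x) :
    Real.log (1 + x / lam) ≤ (1 + lam⁻¹) * Real.log (1 + x) := by
  have hl : 0 < lam⁻¹ := by positivity
  rw [← Real.log_rpow (by linarith)]
  refine Real.log_le_log (by positivity) ?_
  refine le_trans ?_ (one_add_mul_self_le_rpow_one_add (by linarith) (by linarith))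
  rw [div_eq_inv_mul]
  nlinarith

lemma half_le_mul_log {d T : ℕ} (hd : 1 ≤ d) (hT : 1 ≤ T) :
    1 / 2 ≤ (d : ℝ) * Real.log (1 + (T : ℝ) / d) := by
  have hT' : (1 : ℝ) ≤ T := by exact_mod_cast hT
  have hd' : (1 : ℝ) ≤ d := by exact_mod_cast hd
  have h := Real.one_sub_inv_le_log_of_pos (show (0 : ℝ) < 1 + (T : ℝ) / d by positivity)
  have h2 : 1 - (1 + (T : ℝ) / d)⁻¹ = T / (d + T) := by field_simp; ring
  rw [h2] at h
  refine le_trans ?_ (mul_le_mul_of_nonneg_left h (by linarith))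
  rw [← mul_div_assoc, div_le_div_iff₀ (by norm_num) (by linarith)]
  nlinarith

lemma commGap_le {m d T : ℕ} :
    (commGap m d T : ℝ) ≤
      T / (m * (d * Real.log (1 + (T : ℝ) / d)) ^ 2) + 1 := by
  have h : (T : ℝ) / (m * (d * Real.log (1 + (T : ℝ) / d)) ^ 2) =
      (T : ℝ) / ((m : ℝ) * (d : ℝ) ^ 2 * Real.log (1 + (T : ℝ) / (d : ℝ)) ^ 2) := by
    congr 1; ring
  rw [h]
  exact (Nat.ceil_lt_add_one (by positivity)).le

/-- Here X = d log(1 + T/d) and c = 1 + 1/λ. The constant 5 is 2 + 3, one part for each kind of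
epoch. -/
lemma potential_bound_le {m T g X c R : ℝ} (hm : 1 ≤ m) (hT : 1 ≤ T) (hX : 1 / 2 ≤ X)
    (hc : 1 ≤ c) (hR0 : 0 ≤ R) (hR : R ≤ c * X) (hg0 : 0 ≤ g) (hg : g ≤ T / (m * X ^ 2) + 1) :
    √T * √(m * Real.exp 1 * R) + m * √(g * c) * R ≤
      5 * c ^ 2 * √(m * T * X + m ^ 2 * X ^ 3) := by
  have hX0 : 0 < X := by linarith
  set Q := √(m * T * X + m ^ 2 * X ^ 3) with hQ
  have hQ0 : 0 ≤ Q := Real.sqrt_nonneg _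
  have hQsq : Q ^ 2 = m * T * X + m ^ 2 * X ^ 3 := Real.sq_sqrt (by positivity)
  have he : Real.exp 1 ≤ 4 := by linarith [Real.exp_one_lt_d9]
  have hmTX : 0 ≤ m * T * X := by positivity
  have hmX3 : 0 ≤ m ^ 2 * X ^ 3 := by positivity
  have h1 : √T * √(m * Real.exp 1 * R) ≤ 2 * c ^ 2 * Q := by
    rw [← Real.sqrt_mul (by linarith)]
    refine Real.sqrt_le_iff.2 ⟨by positivity, ?_⟩
    calc T * (m * Real.exp 1 * R) ≤ T * (m * 4 * (c * X)) := by gcongr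
      _ = 4 * c * (m * T * X) := by ring
      _ ≤ 4 * c ^ 4 * Q ^ 2 := by
        have : c ≤ c ^ 4 := le_self_pow₀ hc (by norm_num)
        gcongr
        linarith
      _ = _ := by ring
  have h2 : m * √(g * c) * R ≤ 3 * c ^ 2 * Q := by
    have hsq : (m * √(g * c) * R) ^ 2 ≤ (3 * c ^ 2 * Q) ^ 2 := by
      rw [mul_pow, mul_pow, Real.sq_sqrt (by positivity)]
      calc m ^ 2 * (g * c) * R ^ 2
          ≤ m ^ 2 * ((T / (m * X ^ 2) + 1) * c) * (c * X) ^ 2 := by gcongr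
        _ = c ^ 3 * (m * T + m ^ 2 * X ^ 2) := by field_simp
        -- 1 ≤ 2X raises each power of X by one.
        _ ≤ c ^ 3 * (2 * (m * T * X + m ^ 2 * X ^ 3)) := by
          gcongr
          have h3 : 0 ≤ m * T := by positivity
          have h4 : 0 ≤ m ^ 2 * X ^ 2 := by positivity
          nlinarith
        _ ≤ c ^ 4 * (9 * (m * T * X + m ^ 2 * X ^ 3)) := by
          gcongr
          · norm_num
          · norm_num
        _ = _ := by rw [mul_pow, hQsq]; ring
    exact le_of_sq_le_sq hsq (by positivity)
  linarith

/-- Sum of the exploration bonuses of all the agents. -/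
lemma sum_sqrt_invForm_le {m d T : ℕ} {lam : ℝ} {z : ℕ → Fin m → (Fin d → ℝ)} (hm : 1 ≤ m)
    (hd : 1 ≤ d) (hT : 1 ≤ T) (hlam : 0 < lam)
    (hz : ∀ t ∈ Finset.Icc 1 T, ∀ i, z t i ⬝ᵥ z t i ≤ 1) :
    ∑ t ∈ Finset.Icc 1 T, ∑ i, √(invForm (gram m d T lam z t i) (z t i)) ≤
      5 * (1 + lam⁻¹) ^ 2 * √((m : ℝ) * T * d * Real.log (1 + (T : ℝ) / d) +
      (m : ℝ) ^ 2 * (d : ℝ) ^ 3 * Real.log (1 + (T : ℝ) / d) ^ 3) := by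
  have hl : 0 < lam⁻¹ := by positivity
  refine (sum_sqrt_invForm_le_potential hm hd hT hlam hz).trans ?_
  refine (potential_bound_le (X := d * Real.log (1 + (T : ℝ) / d)) (by exact_mod_cast hm)
    (by exact_mod_cast hT) (half_le_mul_log hd hT) (by linarith)
    (sub_nonneg.2 (potential_mono hm hlam (Nat.zero_le T))) ?_ (by positivity) commGap_le).trans ?_
  · refine (potential_sub_le hm hd hlam hz).trans ?_
    rw [← div_div, mul_left_comm]
    exact mul_le_mul_of_nonneg_left (log_one_add_div_le hlam (by positivity)) (by positivity)
  · apply le_of_eq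
    congr 2
    ring

end Numeric

/-! ### Azuma's inequality -/

section Azuma

variable {Ω : Type*} [mΩ : MeasurableSpace Ω] {μ : Measure Ω} [IsProbabilityMeasure μ]

/-- On [-b, b] the convex exponential lies below its chord, which is affine in x. -/
lemma exp_mul_le_cosh_add {s b x : ℝ} (hb : 0 < b) (hx : |x| ≤ b) :
    Real.exp (s * x) ≤ Real.cosh (s * b) + x / b * Real.sinh (s * b) := by
  obtain ⟨h1, h2⟩ := abs_le.1 hx
  have h := convexOn_exp.2 (Set.mem_univ (s * b)) (Set.mem_univ (-(s * b)))
    (show 0 ≤ (1 + x / b) / 2 by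
      have : -1 ≤ x / b := by rw [le_div_iff₀ hb]; linarith
      linarith)
    (show 0 ≤ (1 - x / b) / 2 by
      have : x / b ≤ 1 := by rw [div_le_iff₀ hb]; linarith
      linarith) (by ring)
  simp only [smul_eq_mul] at h
  have h3 : (1 + x / b) / 2 * (s * b) + (1 - x / b) / 2 * -(s * b) = s * x := by field_simp; ring
  rw [h3] at h
  refine h.trans (le_of_eq ?_)
  rw [Real.cosh_eq, Real.sinh_eq]
  ring

/-- **Azuma's inequality** on an arbitrary probability space, for bounded increments that are
orthogonal to the bounded functions of the past. -/
lemma azuma (ℱ : Filtration ℕ mΩ) {D : ℕ → Ω → ℝ} {T : ℕ} {b : ℝ} (hb : 0 < b) (hT : 1 ≤ T)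
    (hmeas : ∀ t ∈ Finset.Icc 1 T, Measurable[ℱ (t + 1)] (D t))
    (hbound : ∀ t ∈ Finset.Icc 1 T, ∀ ω, |D t ω| ≤ b)
    (horth : ∀ t ∈ Finset.Icc 1 T, ∀ h : Ω → ℝ, Measurable[ℱ t] h → (∃ C, ∀ ω, |h ω| ≤ C) →
      ∫ ω, h ω * D t ω ∂μ = 0)
    {δ : ℝ} (hδ : 0 < δ) (hδ1 : δ < 1) :
    μ.real {ω | √(2 * T * b ^ 2 * Real.log (1 / δ)) ≤ ∑ t ∈ Finset.Icc 1 T, D t ω} ≤ δ := by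
  have hSmeas : ∀ n ≤ T, Measurable[ℱ (n + 1)] fun ω => ∑ t ∈ Finset.Icc 1 n, D t ω := by
    intro n hn
    refine Finset.measurable_sum _ fun t ht => ?_
    simp at ht
    exact (hmeas t (by simp; omega)).mono (ℱ.mono (by omega)) le_rfl
  have hSbound : ∀ n ≤ T, ∀ ω, |∑ t ∈ Finset.Icc 1 n, D t ω| ≤ n * b := by
    intro n hn ω
    refine (Finset.abs_sum_le_sum_abs _ _).trans ?_
    refine (Finset.sum_le_card_nsmul _ _ b fun t ht => ?_).trans (by simp)
    simp at ht
    exact hbound t (by simp; omega) ω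
  have hEmeas : ∀ (s : ℝ), ∀ n ≤ T,
      Measurable[ℱ (n + 1)] fun ω => Real.exp (s * ∑ t ∈ Finset.Icc 1 n, D t ω) :=
    fun s n hn => Real.measurable_exp.comp ((hSmeas n hn).const_mul s)
  have hEbound : ∀ (s : ℝ), ∀ n ≤ T, ∀ ω,
      |Real.exp (s * ∑ t ∈ Finset.Icc 1 n, D t ω)| ≤ Real.exp (|s| * (n * b)) := by
    intro s n hn ω
    rw [abs_of_pos (Real.exp_pos _), Real.exp_le_exp]
    refine (le_abs_self _).trans ?_
    rw [abs_mul]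
    exact mul_le_mul_of_nonneg_left (hSbound n hn ω) (abs_nonneg s)
  have hEint : ∀ (s : ℝ), ∀ n ≤ T,
      Integrable (fun ω => Real.exp (s * ∑ t ∈ Finset.Icc 1 n, D t ω)) μ := fun s n hn =>
    Integrable.of_bound ((hEmeas s n hn).mono (ℱ.le _) le_rfl).aestronglyMeasurable _
      (ae_of_all _ (hEbound s n hn))
  have hmgf : ∀ (s : ℝ), ∀ n ≤ T, ∫ ω, Real.exp (s * ∑ t ∈ Finset.Icc 1 n, D t ω) ∂μ ≤
      Real.exp (n * ((s * b) ^ 2 / 2)) := by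
    intro s n
    induction n with
    | zero => intro _; simp
    | succ n ih =>
      intro hn
      have hn' : n ≤ T := by omega
      have hmem : n + 1 ∈ Finset.Icc 1 T := by simp; omega
      have hDm := (hmeas _ hmem).mono (ℱ.le _) le_rfl
      have hint : Integrable (fun ω => Real.exp (s * ∑ t ∈ Finset.Icc 1 n, D t ω) * D (n + 1) ω)
          μ := by
        refine (hEint s n hn').mul_bdd (c := b) hDm.aestronglyMeasurable (ae_of_all _ ?_)
        exact hbound _ hmem
      calc ∫ ω, Real.exp (s * ∑ t ∈ Finset.Icc 1 (n + 1), D t ω) ∂μ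
          ≤ ∫ ω, (Real.exp (s * ∑ t ∈ Finset.Icc 1 n, D t ω) * Real.cosh (s * b) +
              Real.exp (s * ∑ t ∈ Finset.Icc 1 n, D t ω) * D (n + 1) ω *
                (Real.sinh (s * b) / b)) ∂μ := by
            refine integral_mono (hEint s _ hn)
              (((hEint s n hn').mul_const _).add (hint.mul_const _)) fun ω => ?_
            simp only
            rw [Finset.sum_Icc_succ_top (by omega), mul_add, Real.exp_add]
            have h := mul_le_mul_of_nonneg_left
              (exp_mul_le_cosh_add (s := s) hb (hbound _ hmem ω))
              (Real.exp_pos (s * ∑ t ∈ Finset.Icc 1 n, D t ω)).le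
            refine h.trans (le_of_eq ?_)
            ring
        -- The linear term vanishes: the exponential of the earlier sum is bounded and measurable
        -- with respect to the past of round `n + 1`.
        _ = (∫ ω, Real.exp (s * ∑ t ∈ Finset.Icc 1 n, D t ω) ∂μ) * Real.cosh (s * b) := by
            rw [integral_add ((hEint s n hn').mul_const _) (hint.mul_const _),
              integral_mul_const, integral_mul_const,
              horth _ hmem _ (hEmeas s n hn') ⟨_, hEbound s n hn'⟩]
            ring
        _ ≤ Real.exp (n * ((s * b) ^ 2 / 2)) * Real.exp ((s * b) ^ 2 / 2) :=
            mul_le_mul (ih hn') (Real.cosh_le_exp_half_sq _) (Real.cosh_pos _).le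
              (Real.exp_pos _).le
        _ = _ := by rw [← Real.exp_add]; congr 1; push_cast; ring
  have hT' : (0 : ℝ) < T := by exact_mod_cast hT
  have hlog : 0 < Real.log (1 / δ) := Real.log_pos (by rw [lt_div_iff₀ hδ]; linarith)
  set ε := √(2 * T * b ^ 2 * Real.log (1 / δ)) with hε
  have hεsq : ε ^ 2 = 2 * T * b ^ 2 * Real.log (1 / δ) := Real.sq_sqrt (by positivity)
  -- The minimiser of -sε + T(sb)²/2.
  set s := ε / (T * b ^ 2) with hs
  have hs0 : 0 ≤ s := by positivity
  refine (measure_ge_le_exp_mul_mgf ε hs0 (hEint s T le_rfl)).trans ?_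
  calc Real.exp (-s * ε) * mgf (fun ω => ∑ t ∈ Finset.Icc 1 T, D t ω) μ s
      ≤ Real.exp (-s * ε) * Real.exp (T * ((s * b) ^ 2 / 2)) :=
        mul_le_mul_of_nonneg_left (hmgf s T le_rfl) (Real.exp_pos _).le
    _ = Real.exp (-Real.log (1 / δ)) := by
        rw [← Real.exp_add]
        congr 1
        have h1 : -s * ε + T * ((s * b) ^ 2 / 2) = -(ε ^ 2 / (2 * T * b ^ 2)) := by
          rw [hs]; field_simp; ring
        rw [h1, hεsq]
        field_simp
    _ = δ := by rw [one_div, Real.log_inv, neg_neg, Real.exp_log hδ]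

end Azuma

/-! ### Fair policies and confidence regions -/

section Policy

variable {d K : ℕ} {f : ℝ → ℝ} {γ L : ℝ}

lemma sum_merit_pos (hγ : 0 < γ) (hf : ∀ u, γ ≤ f u) (θ : Fin d → ℝ) (X : Fin K → (Fin d → ℝ))
    (hK : 0 < K) : 0 < ∑ a, f (θ ⬝ᵥ X a) := by
  have : Nonempty (Fin K) := ⟨⟨0, hK⟩⟩
  exact Finset.sum_pos (fun a _ => hγ.trans_le (hf _)) Finset.univ_nonempty

lemma fairPolicy_nonneg (hγ : 0 < γ) (hf : ∀ u, γ ≤ f u) (θ : Fin d → ℝ)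
    (X : Fin K → (Fin d → ℝ)) (a : Fin K) : 0 ≤ fairPolicy f θ X a :=
  div_nonneg (hγ.le.trans (hf _)) (Finset.sum_nonneg fun _ _ => hγ.le.trans (hf _))

lemma sum_fairPolicy (hγ : 0 < γ) (hf : ∀ u, γ ≤ f u) (θ : Fin d → ℝ)
    (X : Fin K → (Fin d → ℝ)) (hK : 0 < K) : ∑ a, fairPolicy f θ X a = 1 := by
  simp only [fairPolicy]
  rw [← Finset.sum_div, div_self (sum_merit_pos hγ hf θ X hK).ne']

/-- The change of merits and the change of normalisation contribute equally, whence the 2. Bounding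
1 by f/γ then produces the weights of the policy of `θ`; with `θ` the played parameter, the right
side is an expectation under the actual draw. -/
lemma sum_abs_fairPolicy_sub_le (hγ : 0 < γ) (hL : 0 < L) (hf : ∀ u, γ ≤ f u)
    (hlip : ∀ u v, |f u - f v| ≤ L * |u - v|) (θ' θ : Fin d → ℝ) (X : Fin K → (Fin d → ℝ)) :
    ∑ a, |fairPolicy f θ' X a - fairPolicy f θ X a| ≤
      2 * L / γ * ∑ a, fairPolicy f θ X a * |θ' ⬝ᵥ X a - θ ⬝ᵥ X a| := by
  rcases Nat.eq_zero_or_pos K with rfl | hK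
  · simp
  have hP := sum_merit_pos hγ hf θ' X hK
  have hQ := sum_merit_pos hγ hf θ X hK
  simp only [fairPolicy]
  set P := ∑ a, f (θ' ⬝ᵥ X a)
  set Q := ∑ a, f (θ ⬝ᵥ X a)
  have hpos : ∀ u, 0 < f u := fun u => hγ.trans_le (hf u)
  have hPQ : |Q - P| ≤ ∑ a, |f (θ' ⬝ᵥ X a) - f (θ ⬝ᵥ X a)| := by
    rw [abs_sub_comm, ← Finset.sum_sub_distrib]
    exact Finset.abs_sum_le_sum_abs _ _
  have hterm : ∀ a, |f (θ' ⬝ᵥ X a) / P - f (θ ⬝ᵥ X a) / Q| ≤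
      |f (θ' ⬝ᵥ X a) - f (θ ⬝ᵥ X a)| / Q + f (θ' ⬝ᵥ X a) / P * (|Q - P| / Q) := by
    intro a
    have h : f (θ' ⬝ᵥ X a) / P - f (θ ⬝ᵥ X a) / Q =
        (f (θ' ⬝ᵥ X a) - f (θ ⬝ᵥ X a)) / Q + f (θ' ⬝ᵥ X a) / P * ((Q - P) / Q) := by
      field_simp; ring
    rw [h]
    refine (abs_add_le _ _).trans (le_of_eq ?_)
    rw [abs_div, abs_of_pos hQ, abs_mul, abs_div (Q - P), abs_of_pos hQ,
      abs_of_pos (div_pos (hpos _) hP)]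
  calc _ ≤ ∑ a, (|f (θ' ⬝ᵥ X a) - f (θ ⬝ᵥ X a)| / Q + f (θ' ⬝ᵥ X a) / P * (|Q - P| / Q)) :=
        Finset.sum_le_sum fun a _ => hterm a
    _ = (∑ a, |f (θ' ⬝ᵥ X a) - f (θ ⬝ᵥ X a)|) / Q + |Q - P| / Q := by
        rw [Finset.sum_add_distrib, ← Finset.sum_div, ← Finset.sum_mul, ← Finset.sum_div,
          div_self hP.ne', one_mul]
    _ ≤ 2 * ((∑ a, |f (θ' ⬝ᵥ X a) - f (θ ⬝ᵥ X a)|) / Q) := by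
        rw [two_mul]
        gcongr
    _ ≤ _ := by
        rw [Finset.sum_div, Finset.mul_sum, Finset.mul_sum]
        refine Finset.sum_le_sum fun a _ => ?_
        have h1 : |f (θ' ⬝ᵥ X a) - f (θ ⬝ᵥ X a)| ≤
            f (θ ⬝ᵥ X a) / γ * (L * |θ' ⬝ᵥ X a - θ ⬝ᵥ X a|) := by
          refine (hlip _ _).trans (le_mul_of_one_le_left (by positivity) ?_)
          rw [le_div_iff₀ hγ, one_mul]
          exact hf _
        calc _ ≤ 2 * (f (θ ⬝ᵥ X a) / γ * (L * |θ' ⬝ᵥ X a - θ ⬝ᵥ X a|) / Q) := by gcongr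
          _ = _ := by ring

lemma abs_dotProduct_sub_le {m T : ℕ} {lam b : ℝ} (hm : 1 ≤ m) (hlam : 0 < lam)
    {z : ℕ → Fin m → (Fin d → ℝ)} {y : ℕ → Fin m → ℝ} {t : ℕ} {i : Fin m} {θ θ' : Fin d → ℝ}
    (h' : θ' ∈ confSet m d T lam b z y t i) (h : θ ∈ confSet m d T lam b z y t i)
    (x : Fin d → ℝ) :
    |θ' ⬝ᵥ x - θ ⬝ᵥ x| ≤ 2 * √b * √(invForm (gram m d T lam z t i) x) := by
  have hV := posDef_gram (T := T) (z := z) hm hlam t i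
  have key : ∀ θ ∈ confSet m d T lam b z y t i,
      |(θ - thetaHat m d T lam z y t i) ⬝ᵥ x| ≤ √b * √(invForm (gram m d T lam z t i) x) := by
    intro θ hθ
    have h1 := Real.abs_le_sqrt (sq_dotProduct_le hV x (θ - thetaHat m d T lam z y t i))
    rw [Real.sqrt_mul (invForm_nonneg hV x), dotProduct_comm] at h1
    refine h1.trans ?_
    rw [mul_comm]
    exact mul_le_mul_of_nonneg_right hθ (Real.sqrt_nonneg _)
  have e : θ' ⬝ᵥ x - θ ⬝ᵥ x = (θ' - thetaHat m d T lam z y t i) ⬝ᵥ x -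
      (θ - thetaHat m d T lam z y t i) ⬝ᵥ x := by
    rw [sub_dotProduct, sub_dotProduct]; ring
  rw [e]
  refine (abs_sub _ _).trans ?_
  linarith [key θ' h', key θ h]

lemma dotProduct_self_le_one {x : Fin d → ℝ} (hx : ‖WithLp.toLp 2 x‖ ≤ 1) : x ⬝ᵥ x ≤ 1 := by
  have h : ‖WithLp.toLp 2 x‖ ^ 2 = x ⬝ᵥ x := by
    rw [EuclideanSpace.real_norm_sq_eq]
    simp [dotProduct, sq]
  rw [← h]
  exact pow_le_one₀ (norm_nonneg _) hx

lemma sqrt_le_sqrt_betaMax {m T : ℕ} (β : ℕ → Fin m → ℝ) {t : ℕ} (ht : t ∈ Finset.Icc 1 T)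
    (i : Fin m) : √(β t i) ≤ √(betaMax m T β) := by
  refine Real.sqrt_le_sqrt ?_
  exact le_ciSup (f := fun p : Finset.Icc 1 T × Fin m => β (p.1 : ℕ) p.2)
    (Set.finite_range _).bddAbove (⟨t, ht⟩, i)

/-- Expectation of a sum of functions of independent draws. -/
lemma sum_prod_mul_sum {m : ℕ} (p w : Fin m → Fin K → ℝ) (hp : ∀ i, ∑ a, p i a = 1) :
    ∑ c : Fin m → Fin K, (∏ j, p j (c j)) * ∑ i, w i (c i) = ∑ i, ∑ a, p i a * w i a := by
  simp only [Finset.mul_sum]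
  rw [Finset.sum_comm]
  refine Finset.sum_congr rfl fun i _ => ?_
  -- Placing the weight in the single coordinate `i` keeps a product, so the sum over profiles
  -- factorises.
  have h : ∀ c : Fin m → Fin K, (∏ j, p j (c j)) * w i (c i) =
      ∏ j, p j (c j) * (if j = i then w i (c j) else 1) := by
    intro c
    rw [Finset.prod_mul_distrib, Finset.prod_ite_eq' Finset.univ i]
    simp
  simp only [h]
  rw [← Fintype.piFinset_univ,
    ← Finset.prod_univ_sum (fun _ => Finset.univ) fun j a => p j a * (if j = i then w i a else 1)]
  rw [Finset.prod_eq_single i]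
  · simp
  · intro j _ hj
    simp [hj, hp]
  · simp

end Policy

/-! ### Measurability -/

section Measurability

variable {Ω : Type*} {mΩ : MeasurableSpace Ω} {m d T K : ℕ}

/-- The inverse is the adjugate over the determinant, and both are continuous in the entries;
singular matrices need no separate treatment. -/
lemma measurable_invForm {A : Ω → Matrix (Fin d) (Fin d) ℝ} {x : Ω → Fin d → ℝ}
    (hA : ∀ i j, Measurable fun ω => A ω i j) (hx : Measurable x) :
    Measurable fun ω => invForm (A ω) (x ω) := by
  have h : ∀ ω, invForm (A ω) (x ω) = (A ω).det⁻¹ * (x ω ⬝ᵥ ((A ω).adjugate *ᵥ x ω)) := by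
    intro ω
    rw [invForm, Matrix.inv_def, Matrix.smul_mulVec, dotProduct_smul, Ring.inverse_eq_inv,
      smul_eq_mul]
  simp only [h]
  have hpair : Measurable fun ω => ((fun i j => A ω i j : Fin d → Fin d → ℝ), x ω) :=
    Measurable.prodMk (measurable_pi_lambda _ fun i => measurable_pi_lambda _ fun j => hA i j) hx
  have h1 : Continuous fun q : (Fin d → Fin d → ℝ) × (Fin d → ℝ) => (Matrix.of q.1).det :=
    Continuous.matrix_det continuous_fst
  have h2 : Continuous fun q : (Fin d → Fin d → ℝ) × (Fin d → ℝ) =>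
      q.2 ⬝ᵥ ((Matrix.of q.1).adjugate *ᵥ q.2) :=
    Continuous.dotProduct continuous_snd
      (Continuous.matrix_mulVec (Continuous.matrix_adjugate continuous_fst) continuous_snd)
  exact (h1.measurable.comp hpair).inv.mul (h2.measurable.comp hpair)

lemma measurable_gram {lam : ℝ} {z : Ω → ℕ → Fin m → (Fin d → ℝ)} {t : ℕ} (ht : 1 ≤ t)
    (hz : ∀ s, 1 ≤ s → s < t → ∀ j, Measurable fun ω => z ω s j) (i : Fin m) (a b : Fin d) :
    Measurable fun ω => gram m d T lam (z ω) t i a b := by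
  have hlt := lastComm_lt (m := m) (d := d) (T := T) ht
  have hz' : ∀ s, 1 ≤ s → s < t → ∀ j k, Measurable fun ω => z ω s j k := fun s h1 h2 j k =>
    (measurable_pi_apply k).comp (hz s h1 h2 j)
  simp only [gram, Matrix.add_apply, Matrix.sum_apply, Matrix.vecMulVec_apply]
  refine Measurable.add (Finset.measurable_sum _ fun j _ => Measurable.add measurable_const ?_) ?_
  · refine Finset.measurable_sum _ fun s hs => ?_
    simp at hs
    exact (hz' s (by omega) (by omega) j a).mul (hz' s (by omega) (by omega) j b)
  · refine Finset.measurable_sum _ fun s hs => ?_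
    simp at hs
    exact (hz' s (by omega) (by omega) i a).mul (hz' s (by omega) (by omega) i b)

lemma measurable_apply_countable {E : Type*} [MeasurableSpace E] {X : Ω → Fin K → E} {A : Ω → Fin K}
    (hX : ∀ a, Measurable fun ω => X ω a) (hA : Measurable A) :
    Measurable fun ω => X ω (A ω) := by
  have h : Measurable fun p : Fin K × Ω => X p.2 p.1 := measurable_from_prod_countable_right hX
  exact h.comp (hA.prodMk measurable_id)

lemma measurable_fairPolicy {f : ℝ → ℝ} (hf : Measurable f) {θ : Ω → Fin d → ℝ}
    {X : Ω → Fin K → (Fin d → ℝ)} (hθ : Measurable θ) (hX : ∀ a, Measurable fun ω => X ω a)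
    (a : Fin K) : Measurable fun ω => fairPolicy f (θ ω) (X ω) a := by
  have h : ∀ a, Measurable fun ω => f (θ ω ⬝ᵥ X ω a) := by
    intro a
    refine hf.comp ?_
    simp only [dotProduct]
    exact Finset.measurable_sum _ fun k _ =>
      ((measurable_pi_apply k).comp hθ).mul ((measurable_pi_apply k).comp (hX a))
  exact (h a).div (Finset.measurable_sum _ fun a _ => h a)

end Measurability

/-- Bounded functions of the past can be pulled out of the conditional expectation. -/
lemma integral_mul_sub_indicator_eq_zero {Ω : Type*} {𝒢 m₀ : MeasurableSpace Ω} {μ : Measure Ω}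
    [IsFiniteMeasure μ] (h𝒢 : 𝒢 ≤ m₀) {S : Set Ω} (hS : MeasurableSet S)
    {P u : Ω → ℝ} (hP : μ[S.indicator (fun _ => (1 : ℝ)) | 𝒢] =ᵐ[μ] P)
    (hu : Measurable[𝒢] u) (hub : ∃ C, ∀ ω, |u ω| ≤ C) :
    Integrable (fun ω => u ω * (P ω - S.indicator (fun _ => (1 : ℝ)) ω)) μ ∧
      ∫ ω, u ω * (P ω - S.indicator (fun _ => (1 : ℝ)) ω) ∂μ = 0 := by
  obtain ⟨C, hC⟩ := hub
  have hu' := (hu.mono h𝒢 le_rfl).aestronglyMeasurable (μ := μ)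
  have h1 : Integrable (S.indicator fun _ => (1 : ℝ)) μ := (integrable_const 1).indicator hS
  have hPint : Integrable P μ := integrable_condExp.congr hP
  have hi1 : Integrable (fun ω => u ω * S.indicator (fun _ => (1 : ℝ)) ω) μ :=
    h1.bdd_mul hu' (ae_of_all _ hC)
  have hi2 : Integrable (fun ω => u ω * P ω) μ := hPint.bdd_mul hu' (ae_of_all _ hC)
  have h2 : ∫ ω, u ω * S.indicator (fun _ => (1 : ℝ)) ω ∂μ = ∫ ω, u ω * P ω ∂μ := by
    have h3 := condExp_stronglyMeasurable_mul_of_bound h𝒢 (f := u) hu.stronglyMeasurable h1 C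
      (ae_of_all _ hC)
    have h4 := integral_condExp h𝒢 (μ := μ) (f := u * S.indicator fun _ => (1 : ℝ))
    rw [integral_congr_ae h3] at h4
    refine h4.symm.trans (integral_congr_ae ?_)
    filter_upwards [hP] with ω hω
    simp [hω]
  simp only [mul_sub]
  exact ⟨hi2.sub hi1, by rw [integral_sub hi2 hi1, h2, sub_self]⟩

/-! ### Martingale structure and regret of an execution -/

namespace Run

variable {Ω : Type*} [mΩ : MeasurableSpace Ω] {μ : Measure Ω} {m d T K : ℕ}
  {θstar : Fin d → ℝ} {f : Fin m → ℝ → ℝ} {lam : ℝ} {β : ℕ → Fin m → ℝ}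
  {γ L : ℝ}

/-- Exploration bonus `‖x_t^i(a)‖` in the norm of the inverse of the Gram matrix. -/
noncomputable def bonus (R : Run μ m d T K θstar f lam β) (ω : Ω) (t : ℕ) (i : Fin m)
    (a : Fin K) : ℝ :=
  √(invForm (gram m d T lam (R.chosen ω) t i) (R.ctx t i ω a))

/-- Conditional expectation of the total bonus of a round, minus the total bonus of the actions that
are drawn. -/
noncomputable def bonusGap (R : Run μ m d T K θstar f lam β) (t : ℕ) (ω : Ω) : ℝ :=
  ∑ i, ∑ a, R.policy ω t i a * R.bonus ω t i a - ∑ i, R.bonus ω t i (R.act t i ω)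

lemma bonus_nonneg (R : Run μ m d T K θstar f lam β) (ω : Ω) (t : ℕ) (i : Fin m) (a : Fin K) :
    0 ≤ R.bonus ω t i a := Real.sqrt_nonneg _

lemma bonus_le (R : Run μ m d T K θstar f lam β) (hm : 1 ≤ m) (hlam : 0 < lam) {t : ℕ}
    (ht : t ∈ Finset.Icc 1 T) (ω : Ω) (i : Fin m) (a : Fin K) :
    R.bonus ω t i a ≤ √((m : ℝ) * lam)⁻¹ :=
  Real.sqrt_le_sqrt (invForm_gram_le hm hlam t i
    (dotProduct_self_le_one (R.ctx_norm t ht i ω a)))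

lemma instRegret_le (R : Run μ m d T K θstar f lam β) (hm : 1 ≤ m) (hlam : 0 < lam) (hγ : 0 < γ)
    (hL : 0 < L) (hf : ∀ i u, γ ≤ f i u) (hlip : ∀ i u v, |f i u - f i v| ≤ L * |u - v|)
    {ω : Ω} {t : ℕ} (ht : t ∈ Finset.Icc 1 T) {i : Fin m} (hθ : θstar ∈ R.confRegion ω t i) :
    R.instRegret ω t i ≤
      4 * L * √(betaMax m T β) / γ * ∑ a, R.policy ω t i a * R.bonus ω t i a := by
  refine (sum_abs_fairPolicy_sub_le hγ hL (hf i) (hlip i) θstar (R.opt t i ω)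
    (R.ctx t i ω)).trans ?_
  have h : ∀ a, |θstar ⬝ᵥ R.ctx t i ω a - R.opt t i ω ⬝ᵥ R.ctx t i ω a| ≤
      2 * √(betaMax m T β) * R.bonus ω t i a := by
    intro a
    refine (abs_dotProduct_sub_le hm hlam hθ (R.opt_mem t ht i ω) _).trans ?_
    have := sqrt_le_sqrt_betaMax β ht i
    exact mul_le_mul_of_nonneg_right (by linarith) (R.bonus_nonneg ω t i a)
  calc _ ≤ 2 * L / γ * ∑ a, R.policy ω t i a * (2 * √(betaMax m T β) * R.bonus ω t i a) := by
        refine mul_le_mul_of_nonneg_left (Finset.sum_le_sum fun a _ => ?_) (by positivity)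
        exact mul_le_mul_of_nonneg_left (h a) (fairPolicy_nonneg hγ (hf i) _ _ _)
    _ = _ := by
        rw [Finset.mul_sum, Finset.mul_sum]
        refine Finset.sum_congr rfl fun a _ => ?_
        ring

lemma measurable_chosen (R : Run μ m d T K θstar f lam β) {s t : ℕ} (hs : s ∈ Finset.Icc 1 T)
    (hst : s < t) (j : Fin m) : Measurable[R.hist t] fun ω => R.chosen ω s j :=
  measurable_apply_countable (X := fun ω a => R.ctx s j ω a)
    (fun a => (R.ctx_meas s hs j a).mono (R.hist.mono hst.le) le_rfl)
    ((R.act_meas s hs j).mono (R.hist.mono hst) le_rfl)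

lemma measurable_bonus (R : Run μ m d T K θstar f lam β) {t : ℕ} (ht : t ∈ Finset.Icc 1 T)
    (i : Fin m) (a : Fin K) : Measurable[R.hist t] fun ω => R.bonus ω t i a := by
  have ht' := Finset.mem_Icc.1 ht
  refine Real.continuous_sqrt.measurable.comp
    (measurable_invForm (fun k l => ?_) (R.ctx_meas t ht i a))
  exact measurable_gram ht'.1
    (fun s h1 h2 j => R.measurable_chosen (Finset.mem_Icc.2 ⟨h1, by omega⟩) h2 j) i k l

lemma measurable_policy (R : Run μ m d T K θstar f lam β) (hf : ∀ i, Measurable (f i)) {t : ℕ}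
    (ht : t ∈ Finset.Icc 1 T) (i : Fin m) (a : Fin K) :
    Measurable[R.hist t] fun ω => R.policy ω t i a :=
  measurable_fairPolicy (hf i) (R.opt_meas t ht i) (R.ctx_meas t ht i) a

/-- The event that the actions of round `t` are given by `c`. -/
def actEvent (R : Run μ m d T K θstar f lam β) (t : ℕ) (c : Fin m → Fin K) : Set Ω :=
  {ω | ∀ i, R.act t i ω = c i}

lemma measurableSet_actEvent (R : Run μ m d T K θstar f lam β) {t : ℕ} (ht : t ∈ Finset.Icc 1 T)
    (c : Fin m → Fin K) : MeasurableSet[R.hist (t + 1)] (R.actEvent t c) := by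
  have h : R.actEvent t c = ⋂ i, R.act t i ⁻¹' {c i} := by ext; simp [actEvent]
  rw [h]
  exact MeasurableSet.iInter fun i => R.act_meas t ht i (measurableSet_singleton _)

lemma actions_pos (R : Run μ m d T K θstar f lam β) (hm : 1 ≤ m) (ω : Ω) : 0 < K :=
  (R.act 0 ⟨0, hm⟩ ω).pos

lemma sum_policy (R : Run μ m d T K θstar f lam β) (hm : 1 ≤ m) (hγ : 0 < γ)
    (hf : ∀ i u, γ ≤ f i u) (ω : Ω) (t : ℕ) (i : Fin m) : ∑ a, R.policy ω t i a = 1 :=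
  sum_fairPolicy hγ (hf i) _ _ (R.actions_pos hm ω)

/-- The law of the actions is given for joint profiles, so the gap is expanded over profiles: a
coefficient known before the draw times probability minus indicator. -/
lemma bonusGap_eq (R : Run μ m d T K θstar f lam β) (hm : 1 ≤ m) (hγ : 0 < γ)
    (hf : ∀ i u, γ ≤ f i u) (t : ℕ) (ω : Ω) :
    R.bonusGap t ω = ∑ c : Fin m → Fin K, (∑ i, R.bonus ω t i (c i)) *
      (∏ i, R.policy ω t i (c i) - (R.actEvent t c).indicator (fun _ => (1 : ℝ)) ω) := by
  simp only [mul_sub, Finset.sum_sub_distrib]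
  rw [bonusGap, ← sum_prod_mul_sum _ _ (R.sum_policy hm hγ hf ω t)]
  congr 1
  · exact Finset.sum_congr rfl fun c _ => mul_comm _ _
  · rw [Finset.sum_eq_single (fun i => R.act t i ω)]
    · simp [actEvent]
    · intro c _ hc
      have : ω ∉ R.actEvent t c := fun h => hc (funext fun i => (h i).symm)
      simp [this]
    · simp

lemma abs_bonusGap_le (R : Run μ m d T K θstar f lam β) (hm : 1 ≤ m) (hlam : 0 < lam) (hγ : 0 < γ)
    (hf : ∀ i u, γ ≤ f i u) {t : ℕ} (ht : t ∈ Finset.Icc 1 T) (ω : Ω) :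
    |R.bonusGap t ω| ≤ m * √((m : ℝ) * lam)⁻¹ := by
  have hp : ∀ i a, 0 ≤ R.policy ω t i a := fun i a => fairPolicy_nonneg hγ (hf i) _ _ _
  have h1 : 0 ≤ ∑ i, ∑ a, R.policy ω t i a * R.bonus ω t i a :=
    Finset.sum_nonneg fun i _ => Finset.sum_nonneg fun a _ =>
      mul_nonneg (hp i a) (R.bonus_nonneg ω t i a)
  have h2 : 0 ≤ ∑ i, R.bonus ω t i (R.act t i ω) :=
    Finset.sum_nonneg fun i _ => R.bonus_nonneg ω t i _
  have h3 : ∑ i, R.bonus ω t i (R.act t i ω) ≤ m * √((m : ℝ) * lam)⁻¹ :=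
    (Finset.sum_le_card_nsmul _ _ _ fun i _ => R.bonus_le hm hlam ht ω i _).trans (by simp)
  have h4 : ∑ i, ∑ a, R.policy ω t i a * R.bonus ω t i a ≤ m * √((m : ℝ) * lam)⁻¹ := by
    refine (Finset.sum_le_card_nsmul _ _ _ fun i _ => ?_).trans
      (le_of_eq (by rw [Finset.card_univ, Fintype.card_fin, nsmul_eq_mul]))
    calc ∑ a, R.policy ω t i a * R.bonus ω t i a
        ≤ ∑ a, R.policy ω t i a * √((m : ℝ) * lam)⁻¹ := Finset.sum_le_sum fun a _ =>
          mul_le_mul_of_nonneg_left (R.bonus_le hm hlam ht ω i a) (hp i a)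
      _ = _ := by
        rw [← Finset.sum_mul, R.sum_policy hm hγ hf, one_mul]
  rw [bonusGap, abs_le]
  constructor <;> linarith

lemma measurable_bonusGap (R : Run μ m d T K θstar f lam β) (hm : 1 ≤ m) (hγ : 0 < γ)
    (hf : ∀ i u, γ ≤ f i u) (hfm : ∀ i, Measurable (f i)) {t : ℕ} (ht : t ∈ Finset.Icc 1 T) :
    Measurable[R.hist (t + 1)] (R.bonusGap t) := by
  have hle : R.hist t ≤ R.hist (t + 1) := R.hist.mono (Nat.le_succ t)
  have e : R.bonusGap t = _ := funext fun ω => R.bonusGap_eq hm hγ hf t ω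
  rw [e]
  refine Finset.measurable_sum _ fun c _ => Measurable.mul ?_ (Measurable.sub ?_ ?_)
  · exact Finset.measurable_sum _ fun i _ => (R.measurable_bonus ht i (c i)).mono hle le_rfl
  · exact Finset.measurable_prod _ fun i _ => (R.measurable_policy hfm ht i (c i)).mono hle le_rfl
  · exact measurable_const.indicator (R.measurableSet_actEvent ht c)

lemma integral_mul_bonusGap [IsProbabilityMeasure μ] (R : Run μ m d T K θstar f lam β)
    (hm : 1 ≤ m) (hlam : 0 < lam) (hγ : 0 < γ) (hf : ∀ i u, γ ≤ f i u) {t : ℕ}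
    (ht : t ∈ Finset.Icc 1 T) {h : Ω → ℝ} (hh : Measurable[R.hist t] h)
    (hb : ∃ C, ∀ ω, |h ω| ≤ C) : ∫ ω, h ω * R.bonusGap t ω ∂μ = 0 := by
  obtain ⟨C, hC⟩ := hb
  have key : ∀ c : Fin m → Fin K, _ := fun c =>
    integral_mul_sub_indicator_eq_zero (R.hist.le t)
      (R.hist.le _ _ (R.measurableSet_actEvent ht c)) (R.act_law t ht c)
      (u := fun ω => h ω * ∑ i, R.bonus ω t i (c i))
      (hh.mul (Finset.measurable_sum _ fun i _ => R.measurable_bonus ht i (c i)))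
      ⟨C * (m * √((m : ℝ) * lam)⁻¹), fun ω => by
        have h0 : 0 ≤ ∑ i, R.bonus ω t i (c i) :=
          Finset.sum_nonneg fun i _ => R.bonus_nonneg ω t i _
        rw [abs_mul, abs_of_nonneg h0]
        refine mul_le_mul (hC ω) ?_ h0 ((abs_nonneg _).trans (hC ω))
        exact (Finset.sum_le_card_nsmul _ _ _ fun i _ => R.bonus_le hm hlam ht ω i _).trans
          (by simp)⟩
  have e : ∀ ω, h ω * R.bonusGap t ω = ∑ c : Fin m → Fin K, h ω * (∑ i, R.bonus ω t i (c i)) *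
      (∏ i, R.policy ω t i (c i) - (R.actEvent t c).indicator (fun _ => (1 : ℝ)) ω) := by
    intro ω
    rw [R.bonusGap_eq hm hγ hf, Finset.mul_sum]
    exact Finset.sum_congr rfl fun c _ => (mul_assoc _ _ _).symm
  simp only [e]
  refine (integral_finsetSum _ fun c _ => (key c).1).trans ?_
  exact Finset.sum_eq_zero fun c _ => (key c).2

/-- Pathwise on the confidence event: mean bonuses are the gaps plus the drawn bonuses, and the
latter obey the potential bound. -/
lemma sum_agentRegret_le (R : Run μ m d T K θstar f lam β) (hm : 1 ≤ m) (hd : 1 ≤ d) (hT : 1 ≤ T)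
    (hlam : 0 < lam) (hγ : 0 < γ) (hL : 0 < L) (hf : ∀ i u, γ ≤ f i u)
    (hlip : ∀ i u v, |f i u - f i v| ≤ L * |u - v|) {ω : Ω}
    (hθ : ∀ t ∈ Finset.Icc 1 T, ∀ i, θstar ∈ R.confRegion ω t i) :
    ∑ i, R.agentRegret ω i ≤ 4 * L * √(betaMax m T β) / γ *
      (∑ t ∈ Finset.Icc 1 T, R.bonusGap t ω +
        5 * (1 + lam⁻¹) ^ 2 * √((m : ℝ) * T * d * Real.log (1 + (T : ℝ) / d) +
          (m : ℝ) ^ 2 * (d : ℝ) ^ 3 * Real.log (1 + (T : ℝ) / d) ^ 3)) := by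
  have hW := sum_sqrt_invForm_le (z := R.chosen ω) hm hd hT hlam fun t ht i =>
    dotProduct_self_le_one (R.ctx_norm t ht i ω _)
  have e : ∑ t ∈ Finset.Icc 1 T, ∑ i, ∑ a, R.policy ω t i a * R.bonus ω t i a =
      ∑ t ∈ Finset.Icc 1 T, R.bonusGap t ω +
        ∑ t ∈ Finset.Icc 1 T, ∑ i, R.bonus ω t i (R.act t i ω) := by
    rw [← Finset.sum_add_distrib]
    exact Finset.sum_congr rfl fun t _ => (sub_add_cancel _ _).symm
  calc ∑ i, R.agentRegret ω i
      = ∑ t ∈ Finset.Icc 1 T, ∑ i, R.instRegret ω t i := Finset.sum_comm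
    _ ≤ ∑ t ∈ Finset.Icc 1 T, ∑ i, 4 * L * √(betaMax m T β) / γ *
          ∑ a, R.policy ω t i a * R.bonus ω t i a :=
        Finset.sum_le_sum fun t ht => Finset.sum_le_sum fun i _ =>
          R.instRegret_le hm hlam hγ hL hf hlip ht (hθ t ht i)
    _ = 4 * L * √(betaMax m T β) / γ *
          ∑ t ∈ Finset.Icc 1 T, ∑ i, ∑ a, R.policy ω t i a * R.bonus ω t i a := by
        simp only [Finset.mul_sum]
    _ ≤ _ := by
        rw [e]
        refine mul_le_mul_of_nonneg_left ?_ (by positivity)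
        exact add_le_add_right hW _

lemma agentRegret_nonneg (R : Run μ m d T K θstar f lam β) (ω : Ω) (i : Fin m) :
    0 ≤ R.agentRegret ω i :=
  Finset.sum_nonneg fun _ _ => Finset.sum_nonneg fun _ _ => abs_nonneg _

lemma fairnessRegret_le (R : Run μ m d T K θstar f lam β) (hm : 1 ≤ m) (ω : Ω) :
    R.fairnessRegret ω ≤ ∑ i, R.agentRegret ω i := by
  have hm' : (1 : ℝ) ≤ m := by exact_mod_cast hm
  refine mul_le_of_le_one_left (Finset.sum_nonneg fun i _ => R.agentRegret_nonneg ω i) ?_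
  rw [div_le_one (by linarith)]
  exact hm'

end Run

/-! ### Combination of the two bounds -/

lemma deviation_add_le {m T X c δ lam Q : ℝ} (hm : 1 ≤ m) (hT : 1 ≤ T) (hX : 1 / 2 ≤ X)
    (hlam : 0 < lam) (hc : c = 1 + lam⁻¹) (hδ : 0 < δ) (hδ1 : δ < 1) (hQ : 0 ≤ Q)
    (hQX : m * T * X ≤ Q ^ 2) :
    √(2 * T * (m * √(m * lam)⁻¹) ^ 2 * Real.log (1 / δ)) + 5 * c ^ 2 * Q ≤
      7 * c ^ 2 * √(Real.log (4 / δ)) * Q := by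
  have hl : 0 < lam⁻¹ := by positivity
  have hc1 : 1 ≤ c := by linarith
  have hlog1 : 0 < Real.log (1 / δ) := Real.log_pos (by rw [lt_div_iff₀ hδ]; linarith)
  have hlog : Real.log (1 / δ) ≤ Real.log (4 / δ) :=
    Real.log_le_log (by positivity) (by gcongr; norm_num)
  -- Since 4 > e, the factor √log(4/δ) is at least 1 and can also absorb the deterministic term.
  have hlog4 : 1 ≤ Real.log (4 / δ) := by
    rw [Real.le_log_iff_exp_le (by positivity), le_div_iff₀ hδ]
    nlinarith [Real.exp_one_lt_d9, Real.exp_pos 1]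
  have h1 : 1 ≤ √(Real.log (4 / δ)) := Real.one_le_sqrt.2 hlog4
  have h2 : √(2 * T * (m * √(m * lam)⁻¹) ^ 2 * Real.log (1 / δ)) ≤
      2 * c ^ 2 * √(Real.log (4 / δ)) * Q := by
    refine Real.sqrt_le_iff.2 ⟨by positivity, ?_⟩
    have e : (2 * c ^ 2 * √(Real.log (4 / δ)) * Q) ^ 2 =
        4 * c ^ 4 * Q ^ 2 * Real.log (4 / δ) := by
      rw [mul_pow, mul_pow, Real.sq_sqrt (by linarith)]; ring
    have e2 : 2 * T * (m * √(m * lam)⁻¹) ^ 2 = 2 * (m * T) * lam⁻¹ := by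
      rw [mul_pow, Real.sq_sqrt (by positivity)]; field_simp
    rw [e, e2]
    have h3 : lam⁻¹ ≤ c ^ 4 := le_trans (by linarith) (le_self_pow₀ hc1 (by norm_num))
    have hmT : 0 ≤ m * T := by positivity
    have h4 : 2 * (m * T) ≤ 4 * Q ^ 2 := by nlinarith
    calc 2 * (m * T) * lam⁻¹ * Real.log (1 / δ)
        ≤ (4 * Q ^ 2) * c ^ 4 * Real.log (4 / δ) := by gcongr
      _ = _ := by ring
  have h5 : 5 * c ^ 2 * Q ≤ 5 * c ^ 2 * √(Real.log (4 / δ)) * Q := by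
    refine mul_le_mul_of_nonneg_right ?_ hQ
    exact le_mul_of_one_le_right (by positivity) h1
  linarith

end FedFairX

theorem theorem1 (lam : ℝ) (hlam : 0 < lam) :
    ∃ C : ℝ, 0 < C ∧
      ∀ (m d T K : ℕ) (_ : 1 ≤ m) (_ : 1 ≤ d) (_ : 1 ≤ T)
        (γ L : ℝ) (_ : 0 < γ) (_ : 0 < L)
        (f : Fin m → ℝ → ℝ) (_ : ∀ i u, γ ≤ f i u)
        (_ : ∀ i u v, |f i u - f i v| ≤ L * |u - v|)
        (θstar : Fin d → ℝ) (β : ℕ → Fin m → ℝ)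
        (Ω : Type*) [MeasurableSpace Ω] (μ : Measure Ω) [IsProbabilityMeasure μ]
        (R : FedFairX.Run μ m d T K θstar f lam β)
        (α δ ν : ℝ) (_ : 0 < δ) (_ : δ < 1) (_ : 1 < ν)
        (_ : 1 - α ≤ μ.real {ω | ∀ t ∈ Finset.Icc 1 T, ∀ i, θstar ∈ R.confRegion ω t i}),
        1 - α - δ ≤ μ.real {ω |
          R.fairnessRegret ω ≤ C * √(Real.log (4 / δ)) *
              FedFairX.regretRate m d T ν L γ (FedFairX.betaMax m T β) ∧
          ∑ i : Fin m, R.agentRegret ω i ≤ C * √(Real.log (4 / δ)) *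
              FedFairX.regretRate m d T ν L γ (FedFairX.betaMax m T β)} := by
  -- 5 comes from the drawn bonuses and 2 from the Azuma deviation.
  refine ⟨7 * (1 + lam⁻¹) ^ 2, by positivity, ?_⟩
  intro m d T K hm hd hT γ L hγ hL f hf hlip θstar β Ω _ μ _ R α δ ν hδ hδ1 hν hα
  have hm' : (1 : ℝ) ≤ m := by exact_mod_cast hm
  have hT' : (1 : ℝ) ≤ T := by exact_mod_cast hT
  have hlog := FedFairX.log_pos_of_rounds hd hT
  have hfm : ∀ i, Measurable (f i) := fun i =>
    (LipschitzWith.of_dist_le_mul (K := ⟨L, hL.le⟩) fun u v => hlip i u v).continuous.measurable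
  have hazuma := FedFairX.azuma (μ := μ) R.hist (D := R.bonusGap) (T := T)
    (b := m * √((m : ℝ) * lam)⁻¹) (by positivity) hT
    (fun t ht => R.measurable_bonusGap hm hγ hf hfm ht)
    (fun t ht ω => R.abs_bonusGap_le hm hlam hγ hf ht ω)
    (fun t ht h hh hb => R.integral_mul_bonusGap hm hlam hγ hf ht hh hb) hδ hδ1
  set B := {ω | √(2 * T * (m * √((m : ℝ) * lam)⁻¹) ^ 2 * Real.log (1 / δ)) ≤
    ∑ t ∈ Finset.Icc 1 T, R.bonusGap t ω}
  set S := {ω | R.fairnessRegret ω ≤ 7 * (1 + lam⁻¹) ^ 2 * √(Real.log (4 / δ)) *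
        FedFairX.regretRate m d T ν L γ (FedFairX.betaMax m T β) ∧
      ∑ i : Fin m, R.agentRegret ω i ≤ 7 * (1 + lam⁻¹) ^ 2 * √(Real.log (4 / δ)) *
        FedFairX.regretRate m d T ν L γ (FedFairX.betaMax m T β)}
  -- Off the Azuma event `B`, of probability at most δ, confidence implies the bound; a union bound
  -- then concludes.
  have hsub : {ω | ∀ t ∈ Finset.Icc 1 T, ∀ i, θstar ∈ R.confRegion ω t i} ⊆ S ∪ B := by
    intro ω hω
    by_cases hB : ω ∈ B
    · exact Or.inr hB
    · left
      have hB' : ∑ t ∈ Finset.Icc 1 T, R.bonusGap t ω ≤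
          √(2 * T * (m * √((m : ℝ) * lam)⁻¹) ^ 2 * Real.log (1 / δ)) :=
        le_of_not_ge hB
      have hR := R.sum_agentRegret_le hm hd hT hlam hγ hL hf hlip hω
      have hQX : (m : ℝ) * T * (d * Real.log (1 + (T : ℝ) / d)) ≤
          √((m : ℝ) * T * d * Real.log (1 + (T : ℝ) / d) +
            (m : ℝ) ^ 2 * (d : ℝ) ^ 3 * Real.log (1 + (T : ℝ) / d) ^ 3) ^ 2 := by
        rw [Real.sq_sqrt (by positivity), ← mul_assoc]
        exact le_add_of_nonneg_right (by positivity)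
      have hdev := FedFairX.deviation_add_le hm' hT' (FedFairX.half_le_mul_log hd hT) hlam rfl hδ
        hδ1 (Real.sqrt_nonneg _) hQX
      have hsum : ∑ i : Fin m, R.agentRegret ω i ≤ 7 * (1 + lam⁻¹) ^ 2 * √(Real.log (4 / δ)) *
          FedFairX.regretRate m d T ν L γ (FedFairX.betaMax m T β) := by
        refine hR.trans ((mul_le_mul_of_nonneg_left
          ((add_le_add_left hB' _).trans hdev) (by positivity)).trans ?_)
        rw [FedFairX.regretRate]
        set Q := √((m : ℝ) * T * d * Real.log (1 + (T : ℝ) / d) +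
            (m : ℝ) ^ 2 * (d : ℝ) ^ 3 * Real.log (1 + (T : ℝ) / d) ^ 3)
        have hP : 0 ≤ 4 * L * √(FedFairX.betaMax m T β) / γ *
            (7 * (1 + lam⁻¹) ^ 2 * √(Real.log (4 / δ)) * Q) := by positivity
        -- The factor ν > 1 is pure slack.
        calc _ ≤ ν * (4 * L * √(FedFairX.betaMax m T β) / γ *
              (7 * (1 + lam⁻¹) ^ 2 * √(Real.log (4 / δ)) * Q)) :=
              le_mul_of_one_le_left hP hν.le
          _ = _ := by ring
      exact ⟨(R.fairnessRegret_le hm ω).trans hsum, hsum⟩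
  have h1 := (measureReal_mono (μ := μ) hsub).trans (measureReal_union_le S B)
  linarith
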